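/- Let $r\in\{0,1,2,\dots,\infty\}$. Manifolds are Hausdorff, second countable $C^r$ manifolds, possibly with boundary. A $C^r$ isotopy of $M$ is a family $F=(F_t)_{t\in[0,1]}$ of bijections of $M$ such that $(x,t)\mapsto (F_t(x),t)$ is a $C^r$ diffeomorphism of $M\times[0,1]$ (a homeomorphism if $r=0$). For a group $\mathcal G$ of $C^r$ diffeomorphisms of $M$, its identity component $\mathcal G_0$ is the group of all $F_1$, where $F$ is a $C^r$ isotopy of $M$ with $F_0=\mathrm{id}_M$ and $F_t\in\mathcal G$ for all $t$. A function $\varphi:G\to\mathbb R$ on a group is a quasimorphism if $\sup_{a,b\in G}|\varphi(ab)-\varphi(a)-\varphi(b)|<\infty$. (1) Circle bundles. Let $B$ be a nonempty manifold with $\dim B\ge 1$, let $\mathrm{SO}(2)\le\Gamma\le\mathrm{Diff}^r(\mathbb S^1)$, and let $\pi:M\to B$ be a $C^r$ fiber bundle with fiber $\mathbb S^1$ and structure group $\Gamma$. Let $\mathcal D^r_\pi(M)$ be the group of those $C^r$ diffeomorphisms $f$ of $M$ that map each fiber onto itself ($\pi f=\pi$) and that in the local trivializations are given on each fiber by an element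 of $\Gamma$. Then $\mathcal D^r_\pi(M)_0$ admits a surjective quasimorphism $\mathcal D^r_\pi(M)_0\to\mathbb R$. (2) Foliations. Let $M$ be a manifold of dimension $n\ge 2$ with a $1$-dimensional $C^r$ foliation $\mathcal F$, and let $\mathrm{Diff}^r_L(M,\mathcal F)$ be the group of $C^r$ diffeomorphisms of $M$ that map each leaf onto itself. Suppose that $\mathcal F$ has two circle leaves $S_1,S_2\subset\operatorname{Int}M$ such that (i) $S_1$ and $S_2$ are parallel with respect to an annulus $E$, that is, $E$ is a topologically embedded annulus in $M$ with boundary circles $S_1$ and $S_2$; (ii) there is an $\mathcal F$-saturated subset $N$ of $M$ (a union of leaves) such that $E\subset N$ and the homomorphism $\pi_1(S_1)\to\pi_1(N)$ induced by the inclusion is injective. Then $\mathrm{Diff}^r_L(M,\mathcal F)_0$ admits a surjective quasimorphism $\mathrm{Diff}^r_L(M,\mathcal F)_0\to\mathbb R$. If (i) holds and $E$ itself is $\mathcal F$-saturated, then (ii) holds with $N=E$, so that the same conclusion follows. -/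

import Mathlib

open Set Topology
open scoped Manifold ContDiff

noncomputable section

namespace CircleFoliation

/-! ### Quasimorphisms -/

/-- A real function on a group is a quasimorphism if its defect
`sup |φ (a * b) - φ a - φ b|` is finite. -/
def IsQuasimorphism {G : Type*} [Group G] (φ : G → ℝ) : Prop :=
  ∃ D : ℝ, ∀ a b : G, |φ (a * b) - φ a - φ b| ≤ D

/-- The group `G` admits a surjective quasimorphism onto `ℝ`. -/
def AdmitsSurjectiveQuasimorphism (G : Type*) [Group G] : Prop :=
  ∃ φ : G → ℝ, IsQuasimorphism φ ∧ Function.Surjective φ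

theorem apply_perm_inv {α : Type*} (f : Equiv.Perm α) (x : α) : f (f⁻¹ x) = x :=
  f.apply_symm_apply x

/-! ### Diffeomorphisms, isotopies and identity components -/

section Diffeo

variable {E : Type*} [NormedAddCommGroup E] [NormedSpace ℝ E] {H : Type*} [TopologicalSpace H]

/-- The group of `C^r` diffeomorphisms of `M` (homeomorphisms if `r = 0`), under composition. -/
def diffGroup (I : ModelWithCorners ℝ E H) (r : ℕ∞) (M : Type*) [TopologicalSpace M]
    [ChartedSpace H M] : Subgroup (Equiv.Perm M) where
  carrier := {f | ContMDiff I I r f ∧ ContMDiff I I r f.symm}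
  one_mem' := ⟨contMDiff_id, contMDiff_id⟩
  mul_mem' := fun hf hg => ⟨hf.1.comp hg.1, hg.2.comp hf.2⟩
  inv_mem' := fun hf => ⟨hf.2, hf.1⟩

variable {M : Type*} [TopologicalSpace M] [ChartedSpace H M]

/-- A `C^r` isotopy `(F t)`, `t ∈ [0, 1]`, of `M`: both `(x, t) ↦ F t x` and
`(x, t) ↦ (F t)⁻¹ x` are `C^r` on `M × [0, 1]`; equivalently, `(x, t) ↦ (F t x, t)` is a `C^r`
diffeomorphism of `M × [0, 1]`. -/
def IsIsotopy (I : ModelWithCorners ℝ E H) (r : ℕ∞) (F : unitInterval → Equiv.Perm M) : Prop :=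
  ContMDiff (I.prod (𝓡∂ 1)) I r (fun p : M × unitInterval => F p.2 p.1) ∧
  ContMDiff (I.prod (𝓡∂ 1)) I r (fun p : M × unitInterval => (F p.2).symm p.1)

theorem IsIsotopy.one (I : ModelWithCorners ℝ E H) (r : ℕ∞) :
    IsIsotopy I r (fun _ => (1 : Equiv.Perm M)) :=
  ⟨contMDiff_fst, contMDiff_fst⟩

theorem IsIsotopy.mul {I : ModelWithCorners ℝ E H} {r : ℕ∞} {F G : unitInterval → Equiv.Perm M}
    (hF : IsIsotopy I r F) (hG : IsIsotopy I r G) : IsIsotopy I r (fun t => F t * G t) :=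
  ⟨hF.1.comp (hG.1.prodMk contMDiff_snd), hG.2.comp (hF.2.prodMk contMDiff_snd)⟩

theorem IsIsotopy.inv {I : ModelWithCorners ℝ E H} {r : ℕ∞} {F : unitInterval → Equiv.Perm M}
    (hF : IsIsotopy I r F) : IsIsotopy I r (fun t => (F t)⁻¹) :=
  ⟨hF.2, hF.1⟩

/-- The identity component `G₀ = {F 1}` of a group `G` of diffeomorphisms of `M`, where `F`
runs over the `C^r` isotopies of `M` with `F 0 = id` and `F t ∈ G` for all `t`. -/
def identityComponent (I : ModelWithCorners ℝ E H) (r : ℕ∞) (G : Subgroup (Equiv.Perm M)) :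
    Subgroup (Equiv.Perm M) where
  carrier := {f | ∃ F : unitInterval → Equiv.Perm M,
    IsIsotopy I r F ∧ (∀ t, F t ∈ G) ∧ F 0 = 1 ∧ F 1 = f}
  one_mem' := ⟨fun _ => 1, IsIsotopy.one I r, fun _ => G.one_mem, rfl, rfl⟩
  mul_mem' := by
    rintro f g ⟨F, hF, hFG, hF0, hF1⟩ ⟨F', hF', hFG', hF0', hF1'⟩
    exact ⟨fun t => F t * F' t, hF.mul hF', fun t => G.mul_mem (hFG t) (hFG' t),
      by simp [hF0, hF0'], by simp [hF1, hF1']⟩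
  inv_mem' := by
    rintro f ⟨F, hF, hFG, hF0, hF1⟩
    exact ⟨fun t => (F t)⁻¹, hF.inv, fun t => G.inv_mem (hFG t), by simp [hF0], by simp [hF1]⟩

end Diffeo

/-! ### One-dimensional foliations -/

section Foliation

/-- A foliated `C^r` atlas of leaf dimension one on a `(k + 1)`-manifold `M` possibly with
boundary. Each chart is a `C^r` diffeomorphism from an open subset of `M` onto a product `A × T`
with `A` an open interval of the half line and `T` an open subset of the `k`-dimensional half
space (so parts of the boundary may be tangent or transverse to the leaves). The plaques of a
chart are the preimages of the sets `A × {t}`; the last condition says that the intersection of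
two plaques of two charts is open in each of them. -/
structure LineFoliation (r : ℕ∞) (k : ℕ) [NeZero k] (M : Type*) [TopologicalSpace M]
    [ChartedSpace (EuclideanHalfSpace (k + 1)) M] where
  atlas : Set (OpenPartialHomeomorph M (EuclideanHalfSpace 1 × EuclideanHalfSpace k))
  cover : ∀ x : M, ∃ e ∈ atlas, x ∈ e.source
  target_eq : ∀ e ∈ atlas, ∃ (A : Set (EuclideanHalfSpace 1)) (T : Set (EuclideanHalfSpace k)),
    IsOpen A ∧ IsPreconnected A ∧ IsOpen T ∧ e.target = A ×ˢ T
  contMDiffOn : ∀ e ∈ atlas, ContMDiffOn (𝓡∂ (k + 1)) ((𝓡∂ 1).prod (𝓡∂ k)) r e e.source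
  contMDiffOn_symm : ∀ e ∈ atlas,
    ContMDiffOn ((𝓡∂ 1).prod (𝓡∂ k)) (𝓡∂ (k + 1)) r e.symm e.target
  coherent : ∀ e ∈ atlas, ∀ e' ∈ atlas, ∀ x ∈ e.source ∩ e'.source,
    ∀ᶠ y in 𝓝 x, (e y).2 = (e x).2 → (e' y).2 = (e' x).2

namespace LineFoliation

variable {r : ℕ∞} {k : ℕ} [NeZero k] {M : Type*} [TopologicalSpace M]
  [ChartedSpace (EuclideanHalfSpace (k + 1)) M] (𝓕 : LineFoliation r k M)

/-- Two points lie in a common plaque. -/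
def SamePlaque (x y : M) : Prop :=
  ∃ e ∈ 𝓕.atlas, x ∈ e.source ∧ y ∈ e.source ∧ (e x).2 = (e y).2

/-- Two points lie in the same leaf: they are joined by a finite chain of plaques. -/
def SameLeaf (x y : M) : Prop :=
  Relation.EqvGen 𝓕.SamePlaque x y

/-- The leaf through `x`. -/
def leaf (x : M) : Set M :=
  {y | 𝓕.SameLeaf x y}

/-- A subset of `M` is saturated if it is a union of leaves. -/
def IsSaturated (N : Set M) : Prop :=
  ∀ x ∈ N, 𝓕.leaf x ⊆ N

/-- A circle leaf: a leaf that is homeomorphic to the circle. -/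
def IsCircleLeaf (S : Set M) : Prop :=
  (∃ x, S = 𝓕.leaf x) ∧ Nonempty (Circle ≃ₜ S)

/-- The group of leaf-preserving `C^r` diffeomorphisms: those that map every leaf onto
itself. -/
def leafDiff : Subgroup (Equiv.Perm M) where
  carrier := {f | f ∈ diffGroup (𝓡∂ (k + 1)) r M ∧ ∀ x, 𝓕.SameLeaf x (f x)}
  one_mem' := ⟨Subgroup.one_mem _, fun x => Relation.EqvGen.refl x⟩
  mul_mem' := fun {f g} hf hg => ⟨Subgroup.mul_mem _ hf.1 hg.1, fun x =>
    Relation.EqvGen.trans x (g x) (f (g x)) (hg.2 x) (hf.2 (g x))⟩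
  inv_mem' := fun {f} hf => ⟨Subgroup.inv_mem _ hf.1, fun x => by
    have h := hf.2 (f⁻¹ x)
    rw [apply_perm_inv] at h
    exact Relation.EqvGen.symm _ _ h⟩

/-- The identity component of the group of leaf-preserving `C^r` diffeomorphisms, with respect
to leaf-preserving `C^r` isotopies. -/
def leafDiff₀ : Subgroup (Equiv.Perm M) :=
  identityComponent (𝓡∂ (k + 1)) r 𝓕.leafDiff

end LineFoliation

end Foliation

/-! ### Parallel circles -/

/-- `E` is a topologically embedded annulus in `M` whose two boundary circles are `S₁`
and `S₂`. -/
def AreParallel {M : Type*} [TopologicalSpace M] (S₁ S₂ E : Set M) : Prop :=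
  ∃ h : Circle × unitInterval → M, IsEmbedding h ∧ range h = E ∧
    h '' (univ ×ˢ {0}) = S₁ ∧ h '' (univ ×ˢ {1}) = S₂

/-- The inclusion `S ⊆ N` (with the subspace topologies) induces an injection
`π₁(S, p) → π₁(N, p)`. -/
def InclusionPi1Injective {M : Type*} [TopologicalSpace M] {S N : Set M} (h : S ⊆ N) (p : S) :
    Prop :=
  Function.Injective
    (FundamentalGroup.map (⟨Set.inclusion h, continuous_inclusion h⟩ : C(S, N)) p)

/-! ### Circle bundles with structure group -/

section Bundle

/-- The rotation group `SO(2)` of the circle. -/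
def rotationGroup : Subgroup (Equiv.Perm Circle) :=
  (MulAction.toPermHom Circle Circle).range

variable {EB : Type*} [NormedAddCommGroup EB] [NormedSpace ℝ EB] {HB : Type*} [TopologicalSpace HB]
  {EM : Type*} [NormedAddCommGroup EM] [NormedSpace ℝ EM] {HM : Type*} [TopologicalSpace HM]
  {B : Type*} [TopologicalSpace B] [ChartedSpace HB B]
  {M : Type*} [TopologicalSpace M] [ChartedSpace HM M]

/-- A `C^r` circle bundle structure on `π : M → B` with structure group `Γ`: an atlas of `C^r`
local trivializations whose transition maps are given on each fiber by an element of `Γ`. -/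
structure CircleBundle (IB : ModelWithCorners ℝ EB HB) (IM : ModelWithCorners ℝ EM HM) (r : ℕ∞)
    (Γ : Subgroup (Equiv.Perm Circle)) (π : M → B) where
  atlas : Set (Bundle.Trivialization Circle π)
  cover : ∀ b : B, ∃ e ∈ atlas, b ∈ e.baseSet
  contMDiffOn : ∀ e ∈ atlas, ContMDiffOn IM (IB.prod (𝓡 1)) r e e.source
  contMDiffOn_symm : ∀ e ∈ atlas,
    ContMDiffOn (IB.prod (𝓡 1)) IM r e.toOpenPartialHomeomorph.symm e.target
  transition : ∀ e ∈ atlas, ∀ e' ∈ atlas, ∀ b ∈ e.baseSet ∩ e'.baseSet, ∃ g ∈ Γ, ∀ z : Circle,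
    (e' (e.toOpenPartialHomeomorph.symm (b, z))).2 = g z

namespace CircleBundle

variable {IB : ModelWithCorners ℝ EB HB} {IM : ModelWithCorners ℝ EM HM} {r : ℕ∞}
  {Γ : Subgroup (Equiv.Perm Circle)} {π : M → B} (ξ : CircleBundle IB IM r Γ π)

/-- `f` maps every fiber into itself and, in the local trivializations, it is given on each fiber
by an element of `Γ`. -/
def IsBundleMap (f : M → M) : Prop :=
  (∀ x, π (f x) = π x) ∧
  ∀ e ∈ ξ.atlas, ∀ b ∈ e.baseSet, ∃ g ∈ Γ, ∀ z : Circle,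
    (e (f (e.toOpenPartialHomeomorph.symm (b, z)))).2 = g z

/-- The group of fiber-preserving `C^r` bundle diffeomorphisms: the `C^r` diffeomorphisms of `M`
that map every fiber onto itself by an element of the structure group. -/
def bundleDiff : Subgroup (Equiv.Perm M) where
  carrier := {f | f ∈ diffGroup IM r M ∧ ξ.IsBundleMap f}
  one_mem' := by
    refine ⟨Subgroup.one_mem _, fun x => rfl, fun e he b hb => ⟨1, Γ.one_mem, fun z => ?_⟩⟩
    simp [e.apply_symm_apply' hb]
  mul_mem' := by
    rintro f f' ⟨hf, hf1, hf2⟩ ⟨hf', hf1', hf2'⟩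
    refine ⟨Subgroup.mul_mem _ hf hf', fun x => by simp [hf1, hf1'], fun e he b hb => ?_⟩
    obtain ⟨g, hg, h⟩ := hf2 e he b hb
    obtain ⟨g', hg', h'⟩ := hf2' e he b hb
    refine ⟨g * g', Γ.mul_mem hg hg', fun z => ?_⟩
    have hπ : π (f' (e.toOpenPartialHomeomorph.symm (b, z))) = b := by
      rw [hf1', e.proj_symm_apply' hb]
    have key : e.toOpenPartialHomeomorph.symm (b, g' z) =
        f' (e.toOpenPartialHomeomorph.symm (b, z)) := by
      have h2 := e.symm_apply_mk_proj (e.mem_source.2 (by rw [hπ]; exact hb))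
      rwa [hπ, h' z] at h2
    rw [Equiv.Perm.mul_apply, Equiv.Perm.mul_apply, ← h (g' z), key]
  inv_mem' := by
    rintro f ⟨hf, hf1, hf2⟩
    have hπ : ∀ x, π (f⁻¹ x) = π x := fun x => by
      rw [← hf1 (f⁻¹ x), apply_perm_inv]
    refine ⟨Subgroup.inv_mem _ hf, hπ, fun e he b hb => ?_⟩
    obtain ⟨g, hg, h⟩ := hf2 e he b hb
    refine ⟨g⁻¹, Γ.inv_mem hg, fun z => ?_⟩
    set y := f⁻¹ (e.toOpenPartialHomeomorph.symm (b, z)) with hy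
    have hyb : π y = b := by rw [hy, hπ, e.proj_symm_apply' hb]
    have hy' : e.toOpenPartialHomeomorph.symm (b, (e y).2) = y := by
      conv_lhs => rw [← hyb]
      exact e.symm_apply_mk_proj (e.mem_source.2 (by rw [hyb]; exact hb))
    have h1 := h (e y).2
    rw [hy', hy, apply_perm_inv, e.apply_symm_apply' hb] at h1
    exact (Equiv.eq_symm_apply g).2 h1.symm

/-- The identity component of the group of fiber-preserving `C^r` bundle diffeomorphisms, with
respect to `C^r` isotopies through such diffeomorphisms. -/
def bundleDiff₀ : Subgroup (Equiv.Perm M) :=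
  identityComponent IM r ξ.bundleDiff

end CircleBundle

end Bundle

end CircleFoliation

end

/-! Let `G` preserve two disjoint embedded circles. For an isotopy `F` through `G` that starts at
the identity, follow one point on each circle and let `d F` be the difference of the two total
angles travelled. For a product of isotopies each angle is additive up to a change of base point.
Two distinct points never meet under a family of bijections, so such a change costs at most `2π`.
Hence `d` is a quasimorphism on isotopies, with defect at most `4π`.

It descends to the end map `F 1` as soon as every isotopy with `F 1 = 1` turns both circles by the
same angle, and it is onto as soon as one circle can be turned by any angle while the other stays
fixed. This is `admitsSurjectiveQuasimorphism_of_displacement`; the rest verifies its two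
conditions.

Circle bundles: take the fibers over the ends of a path in a trivializing open set. For a loop of
isotopies the angle is a multiple of `2π` that depends continuously on the fiber, hence it is
constant. Rotations of the fibers cut off by a bump function on the base turn one fiber only.

Foliations: a loop of isotopies sweeps an arc of the annulus across `N`, which shows that its traces
on the two circles are homotopic in `N` once both are moved to `S₁`. Injectivity on `π₁` makes them
homotopic in `S₁`, so the angles agree (`circleDisplacement_eq_of_parallel`). To turn `S₁` with `S₂`
fixed, small pushes inside foliated charts are composed (`exists_leaf_isotopy_displacement`). This
needs an arc of the leaf inside a chart to stay in one plaque, which holds because a leaf meets a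
chart in only countably many plaques. -/

noncomputable section

namespace CircleFoliation

/-! ### Displacement of paths in the circle -/

section Displacement

open unitInterval

/-- The total change of angle along a path in the circle. -/
def displacement (γ : I → Circle) : ℝ :=
  -- The chosen lift is irrelevant by `displacement_eq`; the value `0` only concerns paths without a
  -- continuous lift.
  open Classical in
  if h : ∃ θ : C(I, ℝ), ∀ t, Circle.exp (θ t) = γ t then h.choose 1 - h.choose 0 else 0

theorem exists_angle_lift {γ : I → Circle} (hγ : Continuous γ) {x : ℝ} (hx : Circle.exp x = γ 0) :
    ∃ θ : C(I, ℝ), θ 0 = x ∧ ∀ t, Circle.exp (θ t) = γ t := by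
  obtain ⟨θ, h, h0⟩ := Circle.isCoveringMap_exp.exists_path_lifts ⟨γ, hγ⟩ x hx.symm
  exact ⟨θ, h0, fun t => congrFun h t⟩

theorem exists_angle_lift_square {H : I → I → Circle} (hH : Continuous (Function.uncurry H)) :
    ∃ θ : C(I × I, ℝ), ∀ s t, Circle.exp (θ (s, t)) = H s t := by
  obtain ⟨x, hx⟩ := Circle.exp_surjective (H 0 0)
  obtain ⟨f, -, hf⟩ := exists_angle_lift (γ := H 0) (by fun_prop) hx
  refine ⟨Circle.isCoveringMap_exp.liftHomotopy ⟨Function.uncurry H, hH⟩ f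
    (fun t => (hf t).symm), fun s t => ?_⟩
  exact congrFun (Circle.isCoveringMap_exp.liftHomotopy_lifts ⟨Function.uncurry H, hH⟩ f
    (fun t => (hf t).symm)) (s, t)

/-- The values lie in the discrete group `2πℤ`, so connectedness makes the function constant. -/
theorem eq_of_continuous_of_two_pi_int {X : Type*} [TopologicalSpace X] [PreconnectedSpace X]
    {f : X → ℝ} (hf : Continuous f) (h : ∀ x, Circle.exp (f x) = 1) (x y : X) : f x = f y := by
  have : DiscreteTopology (AddSubgroup.zmultiples (2 * Real.pi)) := inferInstance
  have hmem : ∀ x, f x ∈ AddSubgroup.zmultiples (2 * Real.pi) := fun x => by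
    obtain ⟨n, hn⟩ := Circle.exp_eq_one.1 (h x)
    exact ⟨n, by simp [hn]⟩
  have hg : Continuous (fun x => (⟨f x, hmem x⟩ : AddSubgroup.zmultiples (2 * Real.pi))) :=
    hf.subtype_mk _
  exact congrArg Subtype.val (PreconnectedSpace.constant inferInstance hg (x := x) (y := y))

theorem displacement_eq {γ : I → Circle} {θ : I → ℝ} (hθ : Continuous θ)
    (h : ∀ t, Circle.exp (θ t) = γ t) : displacement γ = θ 1 - θ 0 := by
  have hex : ∃ θ : C(I, ℝ), ∀ t, Circle.exp (θ t) = γ t := ⟨⟨θ, hθ⟩, h⟩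
  rw [displacement, dif_pos hex]
  have := eq_of_continuous_of_two_pi_int (f := fun t => hex.choose t - θ t) (by fun_prop)
    (fun t => by rw [Circle.exp_sub, hex.choose_spec t, h t, div_self']) 1 0
  linarith

/-- If the displacements differed by more than one full turn, the difference of the lifts, measured
in turns, would pass through an integer, and at that moment the two paths would meet. -/
theorem abs_displacement_sub_le {γ γ' : I → Circle} (hγ : Continuous γ) (hγ' : Continuous γ')
    (hne : ∀ t, γ t ≠ γ' t) : |displacement γ - displacement γ'| ≤ 2 * Real.pi := by
  obtain ⟨x, hx⟩ := Circle.exp_surjective (γ 0)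
  obtain ⟨x', hx'⟩ := Circle.exp_surjective (γ' 0)
  obtain ⟨θ, -, hθ⟩ := exists_angle_lift hγ hx
  obtain ⟨θ', -, hθ'⟩ := exists_angle_lift hγ' hx'
  rw [displacement_eq θ.continuous hθ, displacement_eq θ'.continuous hθ']
  by_contra hlt
  rw [not_le] at hlt
  set g : I → ℝ := fun t => (θ t - θ' t) / (2 * Real.pi) with hg
  have hgc : Continuous g := by fun_prop
  have hpi := Real.two_pi_pos
  have hnot : ∀ t (n : ℤ), g t ≠ n := fun t n hn => by
    apply hne t
    rw [← hθ, ← hθ', Circle.exp_eq_exp]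
    refine ⟨n, ?_⟩
    rw [hg] at hn
    simp only at hn
    rw [div_eq_iff hpi.ne'] at hn
    linarith
  have h1 : 1 < |g 1 - g 0| := by
    have : g 1 - g 0 = (θ 1 - θ 0 - (θ' 1 - θ' 0)) / (2 * Real.pi) := by
      simp only [hg]; ring
    rw [this, abs_div, abs_of_pos hpi, one_lt_div hpi]
    exact hlt
  have hconn : OrdConnected (range g) := (isPreconnected_range hgc).ordConnected
  rcases lt_abs.1 h1 with h | h
  · have h2 := Int.lt_floor_add_one (g 0)
    obtain ⟨t, ht⟩ := hconn.out (mem_range_self 0) (mem_range_self 1)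
      (show ((⌊g 0⌋ + 1 : ℤ) : ℝ) ∈ Icc (g 0) (g 1) from by
        have := Int.floor_le (g 0)
        push_cast
        exact ⟨h2.le, by linarith⟩)
    exact hnot t _ ht
  · have h2 := Int.lt_floor_add_one (g 1)
    obtain ⟨t, ht⟩ := hconn.out (mem_range_self 1) (mem_range_self 0)
      (show ((⌊g 1⌋ + 1 : ℤ) : ℝ) ∈ Icc (g 1) (g 0) from by
        have := Int.floor_le (g 1)
        push_cast
        exact ⟨h2.le, by linarith⟩)
    exact hnot t _ ht

/-- Once the square is lifted, a displacement is a difference of corner values, so the diagonal may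
be replaced by two consecutive edges. -/
theorem displacement_diag {H : I → I → Circle} (hH : Continuous (Function.uncurry H)) :
    displacement (fun t => H t t) =
      displacement (fun s => H s 1) + displacement (fun t => H 0 t) := by
  obtain ⟨θ, hθ⟩ := exists_angle_lift_square hH
  rw [displacement_eq (θ := fun t => θ (t, t)) (by fun_prop) (fun t => hθ t t),
    displacement_eq (θ := fun s => θ (s, 1)) (by fun_prop) (fun s => hθ s 1),
    displacement_eq (θ := fun t => θ (0, t)) (by fun_prop) (fun t => hθ 0 t)]
  ring

theorem displacement_eq_of_homotopy_loops {H : I → I → Circle}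
    (hH : Continuous (Function.uncurry H)) (hloop : ∀ s, H s 0 = H s 1) :
    displacement (H 0) = displacement (H 1) := by
  obtain ⟨θ, hθ⟩ := exists_angle_lift_square hH
  rw [displacement_eq (θ := fun t => θ (0, t)) (by fun_prop) (fun t => hθ 0 t),
    displacement_eq (θ := fun t => θ (1, t)) (by fun_prop) (fun t => hθ 1 t)]
  exact eq_of_continuous_of_two_pi_int (f := fun s => θ (s, 1) - θ (s, 0)) (by fun_prop)
    (fun s => by rw [Circle.exp_sub, hθ, hθ, hloop s, div_self']) 0 1

end Displacement

/-! ### A criterion for surjective quasimorphisms -/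

section Criterion

open unitInterval

variable {E : Type*} [NormedAddCommGroup E] [NormedSpace ℝ E] {H : Type*} [TopologicalSpace H]
  {M : Type*} [TopologicalSpace M] [ChartedSpace H M]

/-- The isotopies through `G` that start at the identity. -/
def isotopyGroup (J : ModelWithCorners ℝ E H) (r : ℕ∞) (G : Subgroup (Equiv.Perm M)) :
    Subgroup (unitInterval → Equiv.Perm M) where
  carrier := {F | IsIsotopy J r F ∧ (∀ t, F t ∈ G) ∧ F 0 = 1}
  one_mem' := ⟨IsIsotopy.one J r, fun _ => G.one_mem, rfl⟩
  mul_mem' := by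
    rintro F F' ⟨hF, hFG, hF0⟩ ⟨hF', hFG', hF0'⟩
    exact ⟨hF.mul hF', fun t => G.mul_mem (hFG t) (hFG' t), by simp [hF0, hF0']⟩
  inv_mem' := by
    rintro F ⟨hF, hFG, hF0⟩
    exact ⟨hF.inv, fun t => G.inv_mem (hFG t), by simp [hF0]⟩


/-- The path of the point `j z` under `F`, read off in the embedded circle `j`. -/
def trace (j : Circle → M) (F : I → Equiv.Perm M) (z : Circle) (t : I) : Circle :=
  Function.invFun j (F t (j z))

/-- The displacement of the point `j z` of the embedded circle `j` under `F`. -/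
def circleDisplacement (j : Circle → M) (z : Circle) (F : I → Equiv.Perm M) : ℝ :=
  displacement (trace j F z)

variable {J : ModelWithCorners ℝ E H} {r : ℕ∞} {G : Subgroup (Equiv.Perm M)} {j : Circle → M}
  {F F' : I → Equiv.Perm M}

theorem map_trace (hG : ∀ f ∈ G, ∀ z, f (j z) ∈ range j) (hF : F ∈ isotopyGroup J r G)
    (z : Circle) (t : I) : j (trace j F z t) = F t (j z) :=
  Function.invFun_eq (hG _ (hF.2.1 t) z)

theorem trace_eq (hj : IsEmbedding j) {z w : Circle} {t : I} (h : F t (j z) = j w) :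
    trace j F z t = w := by
  rw [trace, h, Function.leftInverse_invFun hj.injective w]

theorem trace_zero (hj : IsEmbedding j) (hF : F ∈ isotopyGroup J r G) (z : Circle) :
    trace j F z 0 = z :=
  trace_eq hj (by rw [hF.2.2]; rfl)

theorem continuous_trace (hj : IsEmbedding j) (hG : ∀ f ∈ G, ∀ z, f (j z) ∈ range j)
    (hF : F ∈ isotopyGroup J r G) : Continuous (fun p : Circle × I => trace j F p.1 p.2) := by
  rw [hj.continuous_iff]
  refine (hF.1.1.continuous.comp ((hj.continuous.comp continuous_fst).prodMk continuous_snd)).congr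
    fun p => (map_trace hG hF p.1 p.2).symm

theorem trace_mul (hj : IsEmbedding j) (hG : ∀ f ∈ G, ∀ z, f (j z) ∈ range j)
    (hF : F ∈ isotopyGroup J r G) (hF' : F' ∈ isotopyGroup J r G) (z : Circle) (t : I) :
    trace j (F * F') z t = trace j F (trace j F' z t) t :=
  trace_eq hj (by rw [map_trace hG hF, map_trace hG hF']; rfl)

theorem trace_injective (hG : ∀ f ∈ G, ∀ z, f (j z) ∈ range j) (hj : IsEmbedding j)
    (hF : F ∈ isotopyGroup J r G) (t : I) : Function.Injective (fun z => trace j F z t) :=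
  fun z w h => hj.injective ((F t).injective (by
    rw [← map_trace hG hF, ← map_trace hG hF]; exact congrArg j h))

/-- The trace of the product is the diagonal of `(s, t) ↦ F s (F' t ·)`. Running `F'` to its end
before starting `F` gives the same displacement, which is why the base point of the first term
moves. -/
theorem circleDisplacement_mul (hj : IsEmbedding j) (hG : ∀ f ∈ G, ∀ z, f (j z) ∈ range j)
    (hF : F ∈ isotopyGroup J r G) (hF' : F' ∈ isotopyGroup J r G) (z : Circle) :
    circleDisplacement j z (F * F') =
      circleDisplacement j (trace j F' z 1) F + circleDisplacement j z F' := by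
  have hc := continuous_trace hj hG hF
  have hc' := continuous_trace hj hG hF'
  have h := displacement_diag (H := fun s t => trace j F (trace j F' z t) s)
    (hc.comp ((hc'.comp (continuous_const.prodMk continuous_snd)).prodMk continuous_fst))
  rw [circleDisplacement, funext (trace_mul hj hG hF hF' z)]
  simpa only [trace_zero hj hF, circleDisplacement] using h

theorem abs_circleDisplacement_sub_le (hj : IsEmbedding j)
    (hG : ∀ f ∈ G, ∀ z, f (j z) ∈ range j) (hF : F ∈ isotopyGroup J r G) (z w : Circle) :
    |circleDisplacement j z F - circleDisplacement j w F| ≤ 2 * Real.pi := by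
  rcases eq_or_ne z w with rfl | hzw
  · simp [Real.pi_nonneg]
  have hc := continuous_trace hj hG hF
  exact abs_displacement_sub_le (hc.comp (Continuous.prodMk_right z))
    (hc.comp (Continuous.prodMk_right w)) fun t h => hzw (trace_injective hG hj hF t h)

/-- The group extends to isotopies the function `d`, which `hloop` makes a function of the end map;
`hsurj` gives surjectivity. -/
theorem admitsSurjectiveQuasimorphism_of_displacement {j₁ j₂ : Circle → M} {z₁ z₂ : Circle}
    (hj₁ : IsEmbedding j₁) (hj₂ : IsEmbedding j₂)
    (hG₁ : ∀ f ∈ G, ∀ z, f (j₁ z) ∈ range j₁) (hG₂ : ∀ f ∈ G, ∀ z, f (j₂ z) ∈ range j₂)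
    (hloop : ∀ F ∈ isotopyGroup J r G, F 1 = 1 →
      circleDisplacement j₁ z₁ F = circleDisplacement j₂ z₂ F)
    (hsurj : ∀ s : ℝ, ∃ F ∈ isotopyGroup J r G,
      circleDisplacement j₁ z₁ F - circleDisplacement j₂ z₂ F = s) :
    AdmitsSurjectiveQuasimorphism (identityComponent J r G) := by
  set d : (I → Equiv.Perm M) → ℝ :=
    fun F => circleDisplacement j₁ z₁ F - circleDisplacement j₂ z₂ F with hd
  have hadd : ∀ F ∈ isotopyGroup J r G, ∀ K ∈ isotopyGroup J r G,
      |d (F * K) - d F - d K| ≤ 4 * Real.pi := fun F hF K hK => by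
    have e₁ := abs_circleDisplacement_sub_le hj₁ hG₁ hF (trace j₁ K z₁ 1) z₁
    have e₂ := abs_circleDisplacement_sub_le hj₂ hG₂ hF (trace j₂ K z₂ 1) z₂
    simp only [hd]
    rw [circleDisplacement_mul hj₁ hG₁ hF hK, circleDisplacement_mul hj₂ hG₂ hF hK]
    rw [abs_le] at *
    constructor <;> linarith [e₁.1, e₁.2, e₂.1, e₂.2]
  -- `F⁻¹ * K` ends at the identity and returns every base point to itself, so here additivity is
  -- exact and the extra term vanishes by `hloop`.
  have hwell : ∀ F ∈ isotopyGroup J r G, ∀ K ∈ isotopyGroup J r G, F 1 = K 1 → d F = d K := by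
    intro F hF K hK h
    have hL : F⁻¹ * K ∈ isotopyGroup J r G := mul_mem (inv_mem hF) hK
    have hL1 : (F⁻¹ * K) 1 = 1 := by simp [h]
    have e := hloop _ hL hL1
    have ht : ∀ (j : Circle → M) (_ : IsEmbedding j) (z : Circle), trace j (F⁻¹ * K) z 1 = z :=
      fun j hj z => trace_eq hj (by rw [hL1]; rfl)
    simp only [hd]
    rw [show K = F * (F⁻¹ * K) by group, circleDisplacement_mul hj₁ hG₁ hF hL,
      circleDisplacement_mul hj₂ hG₂ hF hL, ht j₁ hj₁, ht j₂ hj₂, e]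
    ring
  have hex : ∀ f : identityComponent J r G, ∃ F ∈ isotopyGroup J r G, F 1 = f := by
    rintro ⟨f, F, hF, hFG, h0, h1⟩
    exact ⟨F, ⟨hF, hFG, h0⟩, h1⟩
  choose Φ hΦ hΦ1 using hex
  refine ⟨fun f => d (Φ f), ⟨4 * Real.pi, fun a b => ?_⟩, fun s => ?_⟩
  · beta_reduce
    rw [hwell (Φ (a * b)) (hΦ _) (Φ a * Φ b) (mul_mem (hΦ a) (hΦ b)) (by
      rw [hΦ1, Pi.mul_apply, hΦ1, hΦ1]; rfl)]
    exact hadd _ (hΦ a) _ (hΦ b)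
  · obtain ⟨F, hF, hs⟩ := hsurj s
    refine ⟨⟨F 1, F, hF.1, hF.2.1, hF.2.2, rfl⟩, ?_⟩
    rw [← hs]
    exact hwell _ (hΦ _) F hF (hΦ1 _)

end Criterion

/-! ### Isotopies supported in a chart -/

section Support

open unitInterval

variable {E : Type*} [NormedAddCommGroup E] [NormedSpace ℝ E] {H : Type*} [TopologicalSpace H]
  {M : Type*} [TopologicalSpace M] [ChartedSpace H M]
  {E' : Type*} [NormedAddCommGroup E'] [NormedSpace ℝ E'] {H' : Type*} [TopologicalSpace H']
  {N : Type*} [TopologicalSpace N] [ChartedSpace H' N]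
  {J : ModelWithCorners ℝ E H} {J' : ModelWithCorners ℝ E' H'} {r : ℕ∞}

theorem circleDisplacement_eq {j : Circle → M} (hj : IsEmbedding j) {F : I → Equiv.Perm M}
    {z : Circle} {θ : I → ℝ} (hθ : Continuous θ) (h : ∀ t, F t (j z) = j (Circle.exp (θ t))) :
    circleDisplacement j z F = θ 1 - θ 0 :=
  displacement_eq hθ fun t => (trace_eq hj (h t)).symm

open Classical in
/-- The conjugate of `κ` by the chart `e`, extended by the identity. -/
def conjExtend (e : OpenPartialHomeomorph M N) (κ : N → N) (x : M) : M :=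
  if x ∈ e.source then e.symm (κ (e x)) else x

theorem conjExtend_of_mem {e : OpenPartialHomeomorph M N} (κ : N → N) {x : M}
    (hx : x ∈ e.source) : conjExtend e κ x = e.symm (κ (e x)) :=
  if_pos hx

theorem conjExtend_of_notMem {e : OpenPartialHomeomorph M N} {κ : N → N} {K : Set N}
    (hκ : ∀ y ∉ K, κ y = y) {x : M} (hx : x ∉ e.symm '' K) : conjExtend e κ x = x := by
  by_cases h : x ∈ e.source
  · rw [conjExtend_of_mem κ h, hκ _ fun hK => hx ⟨e x, hK, e.left_inv h⟩, e.left_inv h]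
  · exact if_neg h

theorem conjExtend_conjExtend {e : OpenPartialHomeomorph M N} {κ τ : N → N}
    (hκ : MapsTo κ e.target e.target) (h : ∀ y, τ (κ y) = y) (x : M) :
    conjExtend e τ (conjExtend e κ x) = x := by
  by_cases hx : x ∈ e.source
  · have h1 := hκ (e.map_source hx)
    rw [conjExtend_of_mem κ hx, conjExtend_of_mem τ (e.map_target h1), e.right_inv h1, h,
      e.left_inv hx]
  · have : conjExtend e κ x = x := if_neg hx
    rw [this]
    exact if_neg hx

/-- Two open sets cover `M`: the chart domain, where the map is a composite of `C^r` maps, and the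
complement of `e.symm '' K`, where it is the identity. The second is open because a compact set in a
Hausdorff space is closed. -/
theorem contMDiff_conjExtend [T2Space M] {e : OpenPartialHomeomorph M N}
    (he : ContMDiffOn J J' r e e.source) (he' : ContMDiffOn J' J r e.symm e.target) {K : Set N}
    (hK : IsCompact K) (hKe : K ⊆ e.target) {Φ : I → N → N}
    (hΦ : ContMDiff (J'.prod (𝓡∂ 1)) J' r (fun p : N × I => Φ p.2 p.1))
    (hsupp : ∀ t, ∀ y ∉ K, Φ t y = y) (hmaps : ∀ t, MapsTo (Φ t) e.target e.target) :
    ContMDiff (J.prod (𝓡∂ 1)) J r (fun p : M × I => conjExtend e (Φ p.2) p.1) := by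
  rintro ⟨x, t⟩
  by_cases hx : x ∈ e.source
  · have h1 : ContMDiffAt (J.prod (𝓡∂ 1)) J' r (fun p : M × I => e p.1) (x, t) :=
      ((he x hx).contMDiffAt (e.open_source.mem_nhds hx)).comp (x, t) contMDiffAt_fst
    have h2 : ContMDiffAt (J.prod (𝓡∂ 1)) J' r (fun p : M × I => Φ p.2 (e p.1)) (x, t) :=
      (hΦ (e x, t)).comp (x, t) (h1.prodMk contMDiffAt_snd)
    have hmem : Φ t (e x) ∈ e.target := hmaps t (e.map_source hx)
    refine (((he' _ hmem).contMDiffAt (e.open_target.mem_nhds hmem)).comp (x, t)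
      h2).congr_of_eventuallyEq ?_
    filter_upwards [(e.open_source.preimage continuous_fst).mem_nhds
      (show (x, t) ∈ Prod.fst ⁻¹' e.source from hx)] with p hp
    exact conjExtend_of_mem _ hp
  · have hcl : IsClosed (e.symm '' K) :=
      (hK.image_of_continuousOn (e.continuousOn_symm.mono hKe)).isClosed
    have hxK : x ∉ e.symm '' K := by
      rintro ⟨y, hy, rfl⟩
      exact hx (e.map_target (hKe hy))
    refine (contMDiffAt_fst : ContMDiffAt (J.prod (𝓡∂ 1)) J r (Prod.fst : M × I → M) (x, t)).congr_of_eventuallyEq ?_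
    filter_upwards [(hcl.isOpen_compl.preimage continuous_fst).mem_nhds
      (show (x, t) ∈ Prod.fst ⁻¹' (e.symm '' K)ᶜ from hxK)] with p hp
    exact conjExtend_of_notMem (hsupp p.2) hp

/-- A point leaving `U` would land outside `K`, on a fixed point, contradicting injectivity. -/
theorem mapsTo_of_perm_eq_self {α : Type*} {κ : Equiv.Perm α} {K U : Set α} (hKU : K ⊆ U)
    (hκ : ∀ y ∉ K, κ y = y) : MapsTo κ U U := fun y hy => by
  by_contra h
  have := κ.injective (hκ (κ y) fun hK => h (hKU hK))
  exact h (this.symm ▸ hy)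

/-- An isotopy of `N` with compact support in the target of the chart `e` of `M` gives an isotopy
of `M`. -/
theorem exists_isotopy_of_chart [T2Space M] {e : OpenPartialHomeomorph M N}
    (he : ContMDiffOn J J' r e e.source) (he' : ContMDiffOn J' J r e.symm e.target) {K : Set N}
    (hK : IsCompact K) (hKe : K ⊆ e.target) {Φ : I → Equiv.Perm N} (hΦ : IsIsotopy J' r Φ)
    (hsupp : ∀ t, ∀ y ∉ K, Φ t y = y) (hΦ0 : Φ 0 = 1) :
    ∃ F : I → Equiv.Perm M, IsIsotopy J r F ∧ F 0 = 1 ∧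
      (∀ t, ∀ x ∈ e.source, F t x = e.symm (Φ t (e x))) ∧
      (∀ t, ∀ x ∉ e.symm '' K, F t x = x) := by
  have hsupp' : ∀ t, ∀ y ∉ K, (Φ t).symm y = y := fun t y hy => by
    rw [Equiv.symm_apply_eq, hsupp t y hy]
  have hm := fun t => mapsTo_of_perm_eq_self hKe (hsupp t)
  have hm' := fun t => mapsTo_of_perm_eq_self hKe (hsupp' t)
  refine ⟨fun t => ⟨conjExtend e (Φ t), conjExtend e (Φ t).symm,
      conjExtend_conjExtend (hm t) (Φ t).symm_apply_apply,
      conjExtend_conjExtend (hm' t) (Φ t).apply_symm_apply⟩,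
    ⟨contMDiff_conjExtend he he' hK hKe hΦ.1 hsupp hm,
      contMDiff_conjExtend he he' hK hKe hΦ.2 hsupp' hm'⟩, ?_,
    fun t x hx => conjExtend_of_mem _ hx, fun t x hx => conjExtend_of_notMem (hsupp t) hx⟩
  ext x
  -- At time `0` the support is empty.
  refine conjExtend_of_notMem (K := ∅) (fun y _ => ?_) (by simp)
  rw [hΦ0]
  rfl

theorem IsIsotopy.mem_diffGroup {F : I → Equiv.Perm M} (hF : IsIsotopy J r F) (t : I) :
    F t ∈ diffGroup J r M :=
  ⟨hF.1.comp (contMDiff_id.prodMk contMDiff_const), hF.2.comp (contMDiff_id.prodMk contMDiff_const)⟩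

theorem contMDiff_smoothBumpFunction [FiniteDimensional ℝ E] [T2Space M] [IsManifold J r M] {c : M}
    (f : SmoothBumpFunction J c) : ContMDiff J 𝓘(ℝ, ℝ) r f := by
  refine contMDiff_of_tsupport fun x hx => ?_
  have hx' : x ∈ (chartAt H c).source := f.tsupport_subset_chartAt_source hx
  refine ContMDiffAt.congr_of_eventuallyEq ?_ <| f.eqOn_source.eventuallyEq_of_mem <|
    (chartAt H c).open_source.mem_nhds hx'
  exact f.toContDiffBump.contDiff.contDiffAt.contMDiffAt.comp _ (contMDiffAt_extChartAt' hx')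

end Support

/-! ### Circle bundles -/

section BundleProof

open unitInterval

/-- Move a point of the half space inwards. -/
def halfSpaceShift (k : ℕ) [NeZero k] (v : EuclideanHalfSpace k) (s : ℝ) : EuclideanHalfSpace k :=
  ⟨v.1 + max s 0 • EuclideanSpace.single 0 1, by
    have := v.2
    simp only [PiLp.add_apply, PiLp.smul_apply, PiLp.single_apply]
    simp
    positivity⟩

theorem continuous_halfSpaceShift (k : ℕ) [NeZero k] (v : EuclideanHalfSpace k) :
    Continuous (halfSpaceShift k v) :=
  Continuous.subtype_mk (by fun_prop) _

/-- Every neighborhood of a point contains a path to another point. -/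
theorem exists_path_ne {k : ℕ} [NeZero k] {B : Type*} [TopologicalSpace B]
    [ChartedSpace (EuclideanHalfSpace k) B] (b : B) {U : Set B} (hU : U ∈ 𝓝 b) :
    ∃ γ : C(I, B), γ 0 = b ∧ γ 1 ≠ b ∧ ∀ s, γ s ∈ U := by
  set c := chartAt (EuclideanHalfSpace k) b
  have hb : b ∈ c.source := mem_chart_source _ b
  set v := c b
  have h0 : halfSpaceShift k v 0 = v := Subtype.ext (by simp [halfSpaceShift])
  have hcb : c.symm v = b := c.left_inv hb
  have hV : c.target ∩ c.symm ⁻¹' U ∈ 𝓝 v :=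
    Filter.inter_mem (c.open_target.mem_nhds (c.map_source hb))
      ((c.continuousAt_symm (c.map_source hb)).preimage_mem_nhds (by rwa [hcb]))
  have hW : halfSpaceShift k v ⁻¹' (c.target ∩ c.symm ⁻¹' U) ∈ 𝓝 0 :=
    (continuous_halfSpaceShift k v).continuousAt.preimage_mem_nhds (by rwa [h0])
  obtain ⟨ε, hε, hball⟩ := Metric.mem_nhds_iff.1 hW
  have hmem : ∀ s : I, halfSpaceShift k v (s * (ε / 2)) ∈ c.target ∩ c.symm ⁻¹' U := fun s => by
    apply hball
    have h1 := s.2.1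
    have h2 := s.2.2
    rw [Metric.mem_ball, Real.dist_eq, sub_zero, abs_of_nonneg (by positivity)]
    nlinarith
  refine ⟨⟨fun s => c.symm (halfSpaceShift k v (s * (ε / 2))), ?_⟩, ?_, ?_, fun s => (hmem s).2⟩
  · exact c.continuousOn_symm.comp_continuous
      ((continuous_halfSpaceShift k v).comp (by fun_prop)) fun s => (hmem s).1
  · simp [h0, hcb]
  · simp only [ContinuousMap.coe_mk, Icc.coe_one, one_mul]
    intro h
    have h1 := hmem 1
    simp only [Icc.coe_one, one_mul] at h1
    have h2 : halfSpaceShift k v (ε / 2) = v := by rw [← c.right_inv h1.1, h]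
    have h3 := congrArg (fun w : EuclideanHalfSpace k => w.1 0) h2
    simp only [halfSpaceShift, PiLp.add_apply, PiLp.smul_apply, PiLp.single_apply] at h3
    simp at h3
    linarith

variable {EB : Type*} [NormedAddCommGroup EB] [NormedSpace ℝ EB] {HB : Type*} [TopologicalSpace HB]
  {B : Type*} [TopologicalSpace B] [ChartedSpace HB B] {IB : ModelWithCorners ℝ EB HB}

/-- Rotation of the fiber of `B × Circle` over `b` by the angle `χ b`. -/
def fiberRotation (χ : B → ℝ) : Equiv.Perm (B × Circle) where
  toFun p := (p.1, Circle.exp (χ p.1) * p.2)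
  invFun p := (p.1, (Circle.exp (χ p.1))⁻¹ * p.2)
  left_inv p := by simp
  right_inv p := by simp

theorem isIsotopy_fiberRotation {r : ℕ∞} {χ : B → ℝ} (hχ : ContMDiff IB 𝓘(ℝ, ℝ) r χ) :
    IsIsotopy (IB.prod (𝓡 1)) r
      (fun t : I => fiberRotation (fun b => (t : ℝ) * χ b)) := by
  have hle : (r : WithTop ℕ∞) ≤ ω := le_top
  have h1 : ContMDiff ((IB.prod (𝓡 1)).prod (𝓡∂ 1)) 𝓘(ℝ, ℝ) r
      (fun p : (B × Circle) × I => (p.2 : ℝ) * χ p.1.1) :=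
    (contMDiff_subtypeVal_Icc.comp contMDiff_snd).mul
      (hχ.comp (contMDiff_fst.comp contMDiff_fst))
  have h2 : ContMDiff ((IB.prod (𝓡 1)).prod (𝓡∂ 1)) (𝓡 1) r
      (fun p : (B × Circle) × I => Circle.exp ((p.2 : ℝ) * χ p.1.1)) :=
    contMDiff_circleExp.comp h1
  have : LieGroup (𝓡 1) r Circle := LieGroup.of_le hle
  exact ⟨(contMDiff_fst.comp contMDiff_fst).prodMk (h2.mul (contMDiff_snd.comp contMDiff_fst)),
    (contMDiff_fst.comp contMDiff_fst).prodMk (h2.inv.mul (contMDiff_snd.comp contMDiff_fst))⟩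

variable {EM : Type*} [NormedAddCommGroup EM] [NormedSpace ℝ EM]
  {HM : Type*} [TopologicalSpace HM] {IM : ModelWithCorners ℝ EM HM}
  {M : Type*} [TopologicalSpace M] [ChartedSpace HM M] {r : ℕ∞}
  {Γ : Subgroup (Equiv.Perm Circle)} {π : M → B}

/-- The fiber over `b` as a circle in the total space. -/
def fiberCircle (e : Bundle.Trivialization Circle π) (b : B) (z : Circle) : M :=
  e.toOpenPartialHomeomorph.symm (b, z)

theorem apply_fiberCircle (e : Bundle.Trivialization Circle π) {b : B} (hb : b ∈ e.baseSet)
    (z : Circle) : e (fiberCircle e b z) = (b, z) :=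
  e.apply_symm_apply' hb

theorem continuous_fiberCircle (e : Bundle.Trivialization Circle π) {X : Type*}
    [TopologicalSpace X] {f : X → B} (hf : Continuous f) (hfe : ∀ x, f x ∈ e.baseSet) {g : X → Circle}
    (hg : Continuous g) : Continuous (fun x => fiberCircle e (f x) (g x)) :=
  e.toOpenPartialHomeomorph.continuousOn_symm.comp_continuous (hf.prodMk hg)
    fun x => e.mem_target.2 (hfe x)

theorem isEmbedding_fiberCircle [T2Space M] (e : Bundle.Trivialization Circle π) {b : B}
    (hb : b ∈ e.baseSet) : IsEmbedding (fiberCircle e b) := by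
  refine ((continuous_fiberCircle e continuous_const (fun _ => hb)
    continuous_id).isClosedEmbedding fun z w h => ?_).isEmbedding
  have := congrArg e h
  rw [id, id, apply_fiberCircle e hb, apply_fiberCircle e hb] at this
  exact congrArg Prod.snd this

theorem fiberCircle_snd (e : Bundle.Trivialization Circle π) {b : B} (hb : b ∈ e.baseSet) {x : M}
    (hx : π x = b) : fiberCircle e b (e x).2 = x := by
  subst hx
  exact e.symm_apply_mk_proj (e.mem_source.2 hb)

/-- The two circles are the fibers over `γ 0 = b` and `γ 1 ≠ b`, read in a single trivialization
that covers the whole path. -/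
theorem admitsSurjectiveQuasimorphism_bundleDiff₀ [T2Space B] [T2Space M]
    [FiniteDimensional ℝ EB] [IsManifold IB r B]
    (ξ : CircleBundle IB IM r Γ π) (hΓ : rotationGroup ≤ Γ) (b : B)
    (hpath : ∀ U ∈ 𝓝 b, ∃ γ : C(I, B), γ 0 = b ∧ γ 1 ≠ b ∧ ∀ s, γ s ∈ U) :
    AdmitsSurjectiveQuasimorphism ξ.bundleDiff₀ := by
  obtain ⟨e, he, hb⟩ := ξ.cover b
  obtain ⟨γ, hγ0, hγ1, hγ⟩ := hpath _ (e.open_baseSet.mem_nhds hb)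
  have hπ : ∀ c ∈ e.baseSet, ∀ z, π (fiberCircle e c z) = c :=
    fun c hc z => e.proj_symm_apply' hc
  have hG : ∀ c ∈ e.baseSet, ∀ f ∈ ξ.bundleDiff, ∀ z,
      f (fiberCircle e c z) ∈ range (fiberCircle e c) := fun c hc f hf z =>
    ⟨_, fiberCircle_snd e hc ((hf.2.1 _).trans (hπ c hc z))⟩
  refine admitsSurjectiveQuasimorphism_of_displacement (J := IM) (r := r) (G := ξ.bundleDiff)
    (j₁ := fiberCircle e (γ 0)) (j₂ := fiberCircle e (γ 1)) (z₁ := 1) (z₂ := 1)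
    (isEmbedding_fiberCircle e (hγ 0)) (isEmbedding_fiberCircle e (hγ 1)) (hG _ (hγ 0))
    (hG _ (hγ 1)) (fun F hF hF1 => ?_) fun s => ?_
  · have hs : ∀ s t, π (F t (fiberCircle e (γ s) 1)) = γ s := fun s t =>
      ((hF.2.1 t).2.1 _).trans (hπ _ (hγ s) 1)
    have htr : ∀ s t, trace (fiberCircle e (γ s)) F 1 t = (e (F t (fiberCircle e (γ s) 1))).2 :=
      fun s t => trace_eq (isEmbedding_fiberCircle e (hγ s))
        (fiberCircle_snd e (hγ s) (hs s t)).symm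
    have hcont : Continuous (fun p : I × I => e (F p.2 (fiberCircle e (γ p.1) 1))) :=
      e.toOpenPartialHomeomorph.continuousOn.comp_continuous
        (hF.1.1.continuous.comp ((continuous_fiberCircle e (γ.continuous.comp continuous_fst)
          (fun p => hγ p.1) continuous_const).prodMk continuous_snd))
        fun p => e.mem_source.2 (by rw [hs]; exact hγ _)
    refine displacement_eq_of_homotopy_loops
      (H := fun s t => trace (fiberCircle e (γ s)) F 1 t) ?_ fun s => ?_
    · exact (continuous_snd.comp hcont).congr fun p => (htr p.1 p.2).symm
    · rw [htr, htr, hF1, hF.2.2]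
  · rw [hγ0]
    have hbasis : (𝓝 b).HasBasis (fun _ : SmoothBumpFunction IB b => True) fun f => tsupport f :=
      SmoothBumpFunction.nhds_basis_tsupport b
    -- The bump `χ` equals `1` at `b` and vanishes at `γ 1`, and its support lies in the
    -- trivializing set.
    obtain ⟨χ, -, hχ⟩ := hbasis.mem_iff.1
      (Filter.inter_mem (e.open_baseSet.mem_nhds hb) (isOpen_ne.mem_nhds hγ1.symm))
    have hχ1 : χ (γ 1) = 0 := image_eq_zero_of_notMem_tsupport fun h => (hχ h).2 rfl
    have hiso := isIsotopy_fiberRotation (contMDiff_smoothBumpFunction (r := r) χ |>.mul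
      (contMDiff_const (c := s)))
    obtain ⟨F, hF, hF0, hFe, hFK⟩ := exists_isotopy_of_chart (ξ.contMDiffOn e he)
      (ξ.contMDiffOn_symm e he) (K := tsupport χ ×ˢ univ)
      (χ.hasCompactSupport.isCompact.prod isCompact_univ)
      (fun p hp => e.mem_target.2 (hχ hp.1).1) hiso
      (fun t y hy => by
        have : χ y.1 = 0 := image_eq_zero_of_notMem_tsupport fun h => hy ⟨h, mem_univ _⟩
        simp [fiberRotation, this])
      (by ext y <;> simp [fiberRotation])
    have hFfib : ∀ t, ∀ c ∈ e.baseSet, ∀ z, F t (fiberCircle e c z) =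
        fiberCircle e c (Circle.exp (t * (χ c * s)) * z) := fun t c hc z => by
      rw [hFe t _ (e.mem_source.2 (by rw [hπ c hc]; exact hc))]
      have := apply_fiberCircle e hc z
      rw [Bundle.Trivialization.coe_coe, this]
      rfl
    have hout : ∀ t x, π x ∉ e.baseSet → F t x = x := fun t x hx => hFK t x (by
      rintro ⟨⟨c, z⟩, hcz, rfl⟩
      have hc := (hχ hcz.1).1
      exact hx (Eq.mpr (congrArg (· ∈ e.baseSet) (hπ c hc z)) hc))
    have hFπ : ∀ t x, π (F t x) = π x := fun t x => by
      by_cases hx : π x ∈ e.baseSet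
      · rw [← fiberCircle_snd e hx rfl, hFfib t _ hx, hπ _ hx, hπ _ hx]
      · rw [hout t x hx]
    refine ⟨F, ⟨hF, fun t => ⟨hF.mem_diffGroup t, hFπ t, fun e' he' c hc => ?_⟩, hF0⟩, ?_⟩
    · by_cases hce : c ∈ e.baseSet
      · obtain ⟨g, hg, hgz⟩ := ξ.transition e' he' e he c ⟨hc, hce⟩
        obtain ⟨g', hg', hgz'⟩ := ξ.transition e he e' he' c ⟨hce, hc⟩
        -- In another trivialization the map is: change to `e`, rotate, change back. All three
        -- factors lie in `Γ`.
        refine ⟨g' * (MulAction.toPermHom Circle Circle (Circle.exp (t * (χ c * s))) * g),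
          mul_mem hg' (mul_mem (hΓ ⟨_, rfl⟩) hg), fun z => ?_⟩
        have h1 : π (e'.toOpenPartialHomeomorph.symm (c, z)) = c := e'.proj_symm_apply' hc
        rw [← fiberCircle_snd e hce h1, hFfib t c hce, hgz]
        exact hgz' _
      · refine ⟨1, one_mem _, fun z => ?_⟩
        rw [hout t _ (by rw [e'.proj_symm_apply' hc]; exact hce), e'.apply_symm_apply' hc]
        rfl
    · rw [circleDisplacement_eq (θ := fun t => t * (χ b * s)) (isEmbedding_fiberCircle e hb)
        (by fun_prop) (fun t => by rw [hFfib t b hb, mul_one]),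
        circleDisplacement_eq (θ := fun t => t * (χ (γ 1) * s))
        (isEmbedding_fiberCircle e (hγ 1)) (by fun_prop)
        (fun t => by rw [hFfib t _ (hγ 1), mul_one])]
      simp [hχ1]

end BundleProof

/-! ### Local pushes along the first coordinate -/

section Push

open unitInterval

/-- The shear of the plane with second component `(u, a) ↦ a + δ * sin u * φ a`, for a function
`φ` whose derivative is small. -/
theorem exists_shear_inverse {φ : ℝ → ℝ} (hφ : ContDiff ℝ ∞ φ) (hc : HasCompactSupport φ) {δ : ℝ}
    (hδ : 0 ≤ δ) (hδφ : ∀ a, δ * |deriv φ a| ≤ 1 / 2) :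
    ∃ g' : ℝ → ℝ → ℝ, ContDiff ℝ ∞ (Function.uncurry g') ∧
      (∀ u a, g' u (a + δ * Real.sin u * φ a) = a) ∧
      (∀ u a, g' u a + δ * Real.sin u * φ (g' u a) = a) := by
  -- The sine keeps the amplitude bounded for all real `u`, so one bound on `δ * |deriv φ a|` serves
  -- every `u`.
  set G : ℝ × ℝ → ℝ × ℝ := fun p => (p.1, p.2 + δ * Real.sin p.1 * φ p.2) with hG
  have hGs : ContDiff ℝ ∞ G := by
    have h2 : ContDiff ℝ ∞ (fun p : ℝ × ℝ => φ p.2) := hφ.comp contDiff_snd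
    have h1 : ContDiff ℝ ∞ (fun p : ℝ × ℝ => Real.sin p.1) := Real.contDiff_sin.comp contDiff_fst
    exact contDiff_fst.prodMk (contDiff_snd.add ((contDiff_const.mul h1).mul h2))
  have hd : ∀ a, HasDerivAt φ (deriv φ a) a := fun a =>
    (hφ.differentiable (by simp)).differentiableAt.hasDerivAt
  have hpos : ∀ u a, 0 < 1 + δ * Real.sin u * deriv φ a := fun u a => by
    have h1 : |δ * Real.sin u * deriv φ a| ≤ 1 / 2 := by
      rw [abs_mul, abs_mul, abs_of_nonneg hδ]
      calc δ * |Real.sin u| * |deriv φ a| = (δ * |deriv φ a|) * |Real.sin u| := by ring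
        _ ≤ (δ * |deriv φ a|) * 1 := by gcongr; exact Real.abs_sin_le_one u
        _ ≤ 1 / 2 := by rw [mul_one]; exact hδφ a
    linarith [(abs_le.1 h1).1]
  have hda : ∀ u a, HasDerivAt (fun a => a + δ * Real.sin u * φ a)
      (1 + δ * Real.sin u * deriv φ a) a := fun u a =>
    (hasDerivAt_id a).add ((hd a).const_mul _)
  have hmono : ∀ u, StrictMono (fun a => a + δ * Real.sin u * φ a) := fun u =>
    strictMono_of_hasDerivAt_pos (hda u) (hpos u)
  have hsurj : ∀ u, Function.Surjective (fun a => a + δ * Real.sin u * φ a) := fun u => by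
    have hev : ∀ᶠ a in Filter.cocompact ℝ, a = a + δ * Real.sin u * φ a := by
      filter_upwards [hc.isCompact.compl_mem_cocompact] with a ha
      rw [image_eq_zero_of_notMem_tsupport ha]
      ring
    have hcont : Continuous φ := hφ.continuous
    exact Continuous.surjective (by fun_prop)
      (Filter.tendsto_id.congr' (hev.filter_mono atTop_le_cocompact))
      (Filter.tendsto_id.congr' (hev.filter_mono atBot_le_cocompact))
  have hbij : Function.Bijective G := by
    constructor
    · rintro ⟨u, a⟩ ⟨v, b⟩ h
      obtain rfl : u = v := congrArg Prod.fst h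
      exact Prod.ext rfl ((hmono u).injective (congrArg Prod.snd h))
    · rintro ⟨u, b⟩
      obtain ⟨a, ha⟩ := hsurj u b
      exact ⟨(u, a), Prod.ext rfl ha⟩
  -- The derivative is triangular with diagonal entries `1` and `1 + δ * sin u * φ'(a) > 0`, hence
  -- invertible, and the inverse bijection is smooth.
  set G' : ℝ × ℝ → (ℝ × ℝ) ≃L[ℝ] (ℝ × ℝ) := fun p =>
    (ContinuousLinearEquiv.refl ℝ ℝ).skewProd
      (ContinuousLinearEquiv.unitsEquivAut ℝ (Units.mk0 _ (hpos p.1 p.2).ne'))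
      ((δ * Real.cos p.1 * φ p.2) • ContinuousLinearMap.id ℝ ℝ) with hG'
  have hderiv : ∀ p, HasFDerivAt G (G' p : ℝ × ℝ →L[ℝ] ℝ × ℝ) p := fun p => by
    have h1 : HasFDerivAt (fun p : ℝ × ℝ => p.1) (ContinuousLinearMap.fst ℝ ℝ ℝ) p :=
      hasFDerivAt_fst
    have h2 : HasFDerivAt (fun p : ℝ × ℝ => p.2) (ContinuousLinearMap.snd ℝ ℝ ℝ) p :=
      hasFDerivAt_snd
    have h3 := (Real.hasDerivAt_sin p.1).comp_hasFDerivAt p h1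
    have h4 := (hd p.2).comp_hasFDerivAt p h2
    have h5 := h1.prodMk (h2.add ((h3.const_mul δ).mul h4))
    refine h5.congr_fderiv ?_
    ext <;> simp [hG']
    ring
  set e := (Equiv.ofBijective G hbij).toHomeomorphOfContinuousOpen hGs.continuous
    (isOpenMap_of_hasStrictFDerivAt_equiv fun p =>
      hGs.contDiffAt.hasStrictFDerivAt' (hderiv p) (by simp)) with he
  have hes : ContDiff ℝ ∞ e.symm := e.contDiff_symm hderiv hGs
  refine ⟨fun u a => (e.symm (u, a)).2, contDiff_snd.comp hes, fun u a => ?_, fun u a => ?_⟩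
  · exact congrArg Prod.snd (e.symm_apply_apply (u, a))
  · have h : G (e.symm (u, a)) = (u, a) := e.apply_symm_apply (u, a)
    have h1 : (e.symm (u, a)).1 = u := congrArg Prod.fst h
    have h2 := congrArg Prod.snd h
    simp only [hG, h1] at h2
    exact h2

/-- A one-parameter family of diffeomorphisms of the line, supported in a small interval. -/
theorem exists_line_push (a₀ : ℝ) {w : ℝ} (hw : 0 < w) :
    ∃ (g : ℝ → Equiv.Perm ℝ) (δ : ℝ), 0 < δ ∧ δ < w ∧
      ContDiff ℝ ∞ (fun p : ℝ × ℝ => g p.1 p.2) ∧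
      ContDiff ℝ ∞ (fun p : ℝ × ℝ => (g p.1).symm p.2) ∧
      (∀ u, ∀ a ∉ Icc (a₀ - w) (a₀ + w), g u a = a) ∧ g 0 = 1 ∧
      ∀ u, g u a₀ = a₀ + δ * Real.sin u := by
  let φ : ContDiffBump a₀ := ⟨w / 2, w, half_pos hw, half_lt_self hw⟩
  have hφ : ContDiff ℝ ∞ φ := φ.contDiff
  obtain ⟨C, hC⟩ := (hφ.continuous_deriv (by simp)).bounded_above_of_compact_support
    φ.hasCompactSupport.deriv
  have hC0 : 0 ≤ C := (norm_nonneg _).trans (hC a₀)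
  -- The second bound gives `δ * |φ'| ≤ 1 / 2`; the first gives `δ < w`.
  set δ := min (w / 2) (1 / (2 * (C + 1))) with hδ
  have hδ0 : 0 < δ := lt_min (half_pos hw) (by positivity)
  obtain ⟨g', hg's, hl, hr⟩ := exists_shear_inverse hφ φ.hasCompactSupport hδ0.le fun a => by
    calc δ * |deriv φ a| ≤ 1 / (2 * (C + 1)) * (C + 1) :=
          mul_le_mul (min_le_right _ _) ((hC a).trans (by linarith)) (abs_nonneg _) (by positivity)
      _ = 1 / 2 := by field_simp
  refine ⟨fun u => ⟨fun a => a + δ * Real.sin u * φ a, g' u, hl u, hr u⟩, δ, hδ0,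
    (min_le_left _ _).trans_lt (half_lt_self hw), ?_, hg's, fun u a ha => ?_, ?_, fun u => ?_⟩
  · have h2 : ContDiff ℝ ∞ (fun p : ℝ × ℝ => φ p.2) := hφ.comp contDiff_snd
    have h1 : ContDiff ℝ ∞ (fun p : ℝ × ℝ => Real.sin p.1) := Real.contDiff_sin.comp contDiff_fst
    exact contDiff_snd.add ((contDiff_const.mul h1).mul h2)
  · have : φ a = 0 := φ.zero_of_le_dist (by
      by_contra h
      rw [not_le, Real.dist_eq, abs_lt] at h
      have h' : |a - a₀| < w := abs_lt.2 h
      rw [abs_lt] at h'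
      exact ha ⟨by linarith, by linarith⟩)
    simp [this]
  · ext a
    simp
  · have : φ a₀ = 1 :=
      φ.one_of_mem_closedBall (Metric.mem_closedBall_self (half_pos hw).le)
    simp [this]

/-- The point of the half line with the given coordinate. -/
def halfLine (a : ℝ) : EuclideanHalfSpace 1 :=
  (𝓡∂ 1).symm (EuclideanSpace.single 0 a)

theorem halfLine_coord {a : ℝ} (ha : 0 ≤ a) : (halfLine a).1 0 = a := by
  simp [halfLine, modelWithCornersEuclideanHalfSpace_symm_apply, ha]

theorem halfLine_self (x : EuclideanHalfSpace 1) : halfLine (x.1 0) = x := by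
  apply Subtype.ext
  ext i
  rw [Subsingleton.elim i 0]
  exact halfLine_coord x.2

theorem contDiff_euclideanSpace_single {r : WithTop ℕ∞} :
    ContDiff ℝ r (fun a : ℝ => (EuclideanSpace.single 0 a : EuclideanSpace ℝ (Fin 1))) := by
  rw [contDiff_euclidean]
  intro i
  rw [Subsingleton.elim i 0]
  have : (fun a : ℝ => (EuclideanSpace.single 0 a : EuclideanSpace ℝ (Fin 1)) 0) = id := by
    ext a
    simp
  rw [this]
  exact contDiff_id

theorem continuous_halfLine : Continuous halfLine :=
  (𝓡∂ 1).continuous_symm.comp (contDiff_euclideanSpace_single (r := 0)).continuous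

theorem continuous_coord : Continuous (fun x : EuclideanHalfSpace 1 => x.1 0) :=
  (continuous_apply 0).comp ((PiLp.continuous_ofLp 2 _).comp continuous_subtype_val)

theorem contMDiff_coord {r : WithTop ℕ∞} :
    ContMDiff (𝓡∂ 1) 𝓘(ℝ, ℝ) r (fun x : EuclideanHalfSpace 1 => x.1 0) :=
  (contDiff_euclidean.1 (contDiff_id (𝕜 := ℝ) (E := EuclideanSpace ℝ (Fin 1))) 0).contMDiff.comp
    (𝓡∂ 1).contMDiff

theorem ContMDiff.halfLine {E : Type*} [NormedAddCommGroup E] [NormedSpace ℝ E] {H : Type*}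
    [TopologicalSpace H] {J : ModelWithCorners ℝ E H} {X : Type*} [TopologicalSpace X]
    [ChartedSpace H X] {r : WithTop ℕ∞} {f : X → ℝ} (hf : ContMDiff J 𝓘(ℝ, ℝ) r f)
    (h0 : ∀ x, 0 ≤ f x) : ContMDiff J (𝓡∂ 1) r (fun x => halfLine (f x)) := by
  refine (𝓡∂ 1).contMDiffOn_symm.comp_contMDiff (contDiff_euclideanSpace_single.contMDiff.comp hf) fun x => ?_
  rw [range_modelWithCornersEuclideanHalfSpace]
  simpa using h0 x

variable {k : ℕ} [NeZero k]

/-- Push the first coordinate of a point of `[0, ∞) × T`, where the push depends on the second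
coordinate. -/
def halfLinePush (g : ℝ → Equiv.Perm ℝ) (hg : ∀ u, MapsTo (g u) (Ici 0) (Ici 0))
    (hg' : ∀ u, MapsTo (g u).symm (Ici 0) (Ici 0)) {T : Type*} (χ : T → ℝ) :
    Equiv.Perm (EuclideanHalfSpace 1 × T) where
  toFun y := (halfLine (g (χ y.2) (y.1.1 0)), y.2)
  invFun y := (halfLine ((g (χ y.2)).symm (y.1.1 0)), y.2)
  left_inv y := by
    simp only
    rw [halfLine_coord (hg _ y.1.2), Equiv.symm_apply_apply, halfLine_self]
  right_inv y := by
    simp only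
    rw [halfLine_coord (hg' _ y.1.2), Equiv.apply_symm_apply, halfLine_self]

/-- A compactly supported isotopy of `[0, ∞) × T` that moves a point along the first coordinate
to any prescribed nearby position. -/
theorem exists_product_push (r : ℕ∞) {W : Set (EuclideanHalfSpace 1 × EuclideanHalfSpace k)}
    {y₀ : EuclideanHalfSpace 1 × EuclideanHalfSpace k} (hW : W ∈ 𝓝 y₀) (ha : 0 < y₀.1.1 0)
    {ε : ℝ} (hε : 0 < ε) :
    ∃ η > 0, ∃ K ⊆ W, IsCompact K ∧ ∀ c : ℝ, |c - y₀.1.1 0| < η →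
      ∃ (Φ : I → Equiv.Perm (EuclideanHalfSpace 1 × EuclideanHalfSpace k)) (p : C(I, ℝ)),
        IsIsotopy ((𝓡∂ 1).prod (𝓡∂ k)) r Φ ∧ Φ 0 = 1 ∧ (∀ t, ∀ y ∉ K, Φ t y = y) ∧
        (∀ t y, (Φ t y).2 = y.2) ∧ (∀ t, Φ t y₀ = (halfLine (p t), y₀.2)) ∧
        p 0 = y₀.1.1 0 ∧ p 1 = c ∧ ∀ t, |p t - y₀.1.1 0| < ε := by
  obtain ⟨α₀, τ₀⟩ := y₀
  set a₀ := α₀.1 0 with ha₀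
  simp only at ha ⊢
  obtain ⟨W₁, hW₁, W₂, hW₂, hWW⟩ := mem_nhds_prod_iff.1 hW
  obtain ⟨w₁, hw₁, hball₁⟩ : ∃ w₁ > 0, ∀ a, |a - a₀| < w₁ → halfLine a ∈ W₁ := by
    have h : halfLine ⁻¹' W₁ ∈ 𝓝 a₀ := continuous_halfLine.continuousAt.preimage_mem_nhds (by
      rwa [ha₀, halfLine_self])
    obtain ⟨w₁, hw₁, hb⟩ := Metric.mem_nhds_iff.1 h
    exact ⟨w₁, hw₁, fun a h => hb (by rwa [Metric.mem_ball, Real.dist_eq])⟩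
  obtain ⟨ρ, hρ, hball₂⟩ : ∃ ρ > 0, ∀ τ : EuclideanHalfSpace k, dist τ.1 τ₀.1 ≤ ρ → τ ∈ W₂ := by
    have hind : IsInducing (Subtype.val : EuclideanHalfSpace k → EuclideanSpace ℝ (Fin k)) :=
      IsInducing.subtypeVal
    rw [hind.nhds_eq_comap] at hW₂
    obtain ⟨V, hV, hVW⟩ := hW₂
    obtain ⟨ρ, hρ, hb⟩ := Metric.mem_nhds_iff.1 hV
    exact ⟨ρ / 2, half_pos hρ, fun τ h => hVW (hb (h.trans_lt (half_lt_self hρ)))⟩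
  -- The interval of radius `w` about `a₀` must stay inside `W₁`, inside the half line, and within
  -- `ε` of `a₀`.
  set w := min (w₁ / 2) (min a₀ ε) with hwdef
  have hw : 0 < w := lt_min (half_pos hw₁) (lt_min ha hε)
  have hww₁ : w < w₁ := (min_le_left _ _).trans_lt (half_lt_self hw₁)
  have hwa : w ≤ a₀ := (min_le_right _ _).trans (min_le_left _ _)
  have hwε : w ≤ ε := (min_le_right _ _).trans (min_le_right _ _)
  obtain ⟨g, δ, hδ, hδw, hgs, hgs', hsupp, hg0, hga⟩ := exists_line_push a₀ hw
  have hsupp' : ∀ u, ∀ a ∉ Icc (a₀ - w) (a₀ + w), (g u).symm a = a := fun u a h => by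
    rw [Equiv.symm_apply_eq, hsupp u a h]
  have hsub : Icc (a₀ - w) (a₀ + w) ⊆ Ici 0 := fun a h => by
    have := h.1
    rw [mem_Ici]
    linarith
  have hg := fun u => mapsTo_of_perm_eq_self hsub (hsupp u)
  have hg' := fun u => mapsTo_of_perm_eq_self hsub (hsupp' u)
  let b : ContDiffBump τ₀.1 := ⟨ρ / 2, ρ, half_pos hρ, half_lt_self hρ⟩
  set K₂ : Set (EuclideanHalfSpace k) := Subtype.val ⁻¹' Metric.closedBall τ₀.1 ρ with hK₂
  have hK₂c : IsCompact K₂ :=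
    ((𝓡∂ k).isClosedEmbedding).isCompact_preimage (isCompact_closedBall τ₀.1 ρ)
  refine ⟨δ, hδ, (halfLine '' Icc (a₀ - w) (a₀ + w)) ×ˢ K₂, ?_,
    (isCompact_Icc.image continuous_halfLine).prod hK₂c, fun c hc => ?_⟩
  · rintro ⟨_, τ⟩ ⟨⟨a, h, rfl⟩, hτ⟩
    refine hWW ⟨hball₁ a ?_, hball₂ τ hτ⟩
    rw [abs_lt]
    constructor <;> linarith [h.1, h.2]
  -- At full strength the point `a₀` goes to `a₀ + δ * sin s`, so every `c` closer than `δ` is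
  -- reached; this is why `η = δ`.
  set s := Real.arcsin ((c - a₀) / δ) with hs
  have hsin : δ * Real.sin s = c - a₀ := by
    have h1 : |(c - a₀) / δ| ≤ 1 := by
      rw [abs_div, abs_of_pos hδ, div_le_one hδ]
      exact hc.le
    rw [abs_le] at h1
    rw [hs, Real.sin_arcsin h1.1 h1.2]
    field_simp
  have hu : ContMDiff (((𝓡∂ 1).prod (𝓡∂ k)).prod (𝓡∂ 1)) 𝓘(ℝ, ℝ) r
      (fun p : (EuclideanHalfSpace 1 × EuclideanHalfSpace k) × I =>
        (p.2 : ℝ) * (b p.1.2.1 * s)) := by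
    have hb : ContMDiff (𝓡∂ k) 𝓘(ℝ, ℝ) r (fun τ : EuclideanHalfSpace k => b τ.1) :=
      b.contDiff.contMDiff.comp (𝓡∂ k).contMDiff
    exact (contMDiff_subtypeVal_Icc.comp contMDiff_snd).mul
      ((hb.comp (contMDiff_snd.comp contMDiff_fst)).mul contMDiff_const)
  have hu' : ContMDiff (((𝓡∂ 1).prod (𝓡∂ k)).prod (𝓡∂ 1)) 𝓘(ℝ, ℝ × ℝ) r
      (fun p : (EuclideanHalfSpace 1 × EuclideanHalfSpace k) × I =>
        ((p.2 : ℝ) * (b p.1.2.1 * s), p.1.1.1 0)) :=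
    hu.prodMk_space (contMDiff_coord.comp (contMDiff_fst.comp contMDiff_fst))
  have hrle : (r : WithTop ℕ∞) ≤ ∞ := by exact_mod_cast le_top
  refine ⟨fun t => halfLinePush g hg hg' (fun τ => t * (b τ.1 * s)),
    ⟨fun t => a₀ + δ * Real.sin (t * s), by fun_prop⟩, ⟨?_, ?_⟩, ?_, fun t y hy => ?_,
    fun t y => rfl, fun t => ?_, by simp, by simp [hsin], fun t => ?_⟩
  · exact (ContMDiff.halfLine (((hgs.of_le hrle).contMDiff).comp hu') fun p => hg _ p.1.1.2).prodMk
      (contMDiff_snd.comp contMDiff_fst)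
  · exact (ContMDiff.halfLine (((hgs'.of_le hrle).contMDiff).comp hu')
      fun p => hg' _ p.1.1.2).prodMk (contMDiff_snd.comp contMDiff_fst)
  · ext1 y
    simp [halfLinePush, hg0, halfLine_self]
  · refine Prod.ext ?_ rfl
    change halfLine (g (t * (b y.2.1 * s)) (y.1.1 0)) = y.1
    by_cases hτ : y.2 ∈ K₂
    · rw [hsupp _ _ fun h => hy ⟨⟨_, h, halfLine_self _⟩, hτ⟩, halfLine_self]
    · have : b y.2.1 = 0 := b.zero_of_le_dist (not_le.1 hτ).le
      simp [this, hg0, halfLine_self]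
  · have : b τ₀.1 = 1 :=
      b.one_of_mem_closedBall (Metric.mem_closedBall_self (half_pos hρ).le)
    simp [halfLinePush, this, hga, ← ha₀]
  · simp only [ContinuousMap.coe_mk, add_sub_cancel_left, abs_mul, abs_of_pos hδ]
    calc δ * |Real.sin (t * s)| ≤ δ * 1 := by gcongr; exact Real.abs_sin_le_one _
      _ < ε := by linarith

end Push

/-! ### Plaques of a leaf -/

theorem exists_countable_closed_superset {α : Type*} (succ : α → Set α)
    (hsucc : ∀ a, (succ a).Countable) {S : Set α} (hS : S.Countable) :
    ∃ W : Set α, W.Countable ∧ S ⊆ W ∧ ∀ a ∈ W, succ a ⊆ W := by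
  let V : ℕ → Set α := fun n => Nat.rec S (fun _ X => ⋃ a ∈ X, succ a) n
  have hV : ∀ n, (V n).Countable := fun n => by
    induction n with
    | zero => exact hS
    | succ n ih => exact ih.biUnion fun a _ => hsucc a
  refine ⟨⋃ n, V n, countable_iUnion hV, subset_iUnion V 0, fun a ha => ?_⟩
  obtain ⟨n, hn⟩ := mem_iUnion.1 ha
  exact fun b hb => mem_iUnion.2 ⟨n + 1, mem_biUnion hn hb⟩

/-- Every fiber is open, so a countable dense set meets each nonempty one. -/
theorem countable_range_of_isLocallyConstant {X Y : Type*} [TopologicalSpace X]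
    [TopologicalSpace.SeparableSpace X] {f : X → Y} (hf : IsLocallyConstant f) :
    (range f).Countable := by
  obtain ⟨D, hD, hdense⟩ := TopologicalSpace.exists_countable_dense X
  refine (hD.image f).mono ?_
  rintro _ ⟨x, rfl⟩
  obtain ⟨y, hy, hyD⟩ := hdense.inter_open_nonempty _ (hf.isOpen_fiber (f x)) ⟨x, rfl⟩
  exact ⟨y, hyD, hy⟩

namespace LineFoliation

variable {r : ℕ∞} {k : ℕ} [NeZero k] {M : Type*} [TopologicalSpace M]
  [ChartedSpace (EuclideanHalfSpace (k + 1)) M] (𝓕 : LineFoliation r k M)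

/-- A plaque of one chart meets only countably many plaques of another one. -/
theorem countable_plaques_meeting [SecondCountableTopology M]
    {e e' : OpenPartialHomeomorph M (EuclideanHalfSpace 1 × EuclideanHalfSpace k)}
    (he : e ∈ 𝓕.atlas) (he' : e' ∈ 𝓕.atlas) (τ : EuclideanHalfSpace k) :
    {τ' | ∃ x ∈ e.source ∩ e'.source, (e x).2 = τ ∧ (e' x).2 = τ'}.Countable := by
  let X : Set M := {x | x ∈ e.source ∩ e'.source ∧ (e x).2 = τ}
  -- Coherence makes the `e'`-plaque locally constant along a plaque of `e`, and `X` is separable.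
  have hloc : IsLocallyConstant (fun x : X => (e' x.1).2) := by
    rw [IsLocallyConstant.iff_eventually_eq]
    intro x
    filter_upwards [continuous_subtype_val.continuousAt.eventually
      (𝓕.coherent e he e' he' x.1 x.2.1)] with y hy
    exact hy (y.2.2.trans x.2.2.symm)
  refine (countable_range_of_isLocallyConstant hloc).mono ?_
  rintro τ' ⟨x, hx, h, h'⟩
  exact ⟨⟨x, hx, h⟩, h'⟩

/-- A leaf meets a foliated chart in countably many plaques. -/
theorem countable_plaques_of_leaf [SecondCountableTopology M]
    {e : OpenPartialHomeomorph M (EuclideanHalfSpace 1 × EuclideanHalfSpace k)}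
    (he : e ∈ 𝓕.atlas) (x : M) :
    {τ | ∃ y ∈ 𝓕.leaf x ∩ e.source, (e y).2 = τ}.Countable := by
  obtain ⟨T, hT, hTU⟩ := TopologicalSpace.isOpen_iUnion_countable
    (fun c : 𝓕.atlas => c.1.source) (fun c => c.1.open_source)
  have hcover : ∀ y, ∃ c ∈ T, y ∈ c.1.source := fun y => by
    obtain ⟨c, hc, hy⟩ := 𝓕.cover y
    have : y ∈ ⋃ c ∈ T, c.1.source := by
      rw [hTU]
      exact mem_iUnion.2 ⟨⟨c, hc⟩, hy⟩
    simpa using this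
  have hTe : (insert (⟨e, he⟩ : 𝓕.atlas) T).Countable := hT.insert _
  set C := insert (⟨e, he⟩ : 𝓕.atlas) T with hC
  obtain ⟨c₀, hc₀, hx⟩ := hcover x
  -- `W` collects the plaques reached from that of `x` by successive intersections, using only the
  -- countably many charts in `C`.
  obtain ⟨W, hW, hxW, hsucc⟩ := exists_countable_closed_superset
    (fun p : 𝓕.atlas × EuclideanHalfSpace k => ⋃ c ∈ C, Prod.mk c ''
      {τ' | ∃ y ∈ p.1.1.source ∩ c.1.source, (p.1.1 y).2 = p.2 ∧ (c.1 y).2 = τ'})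
    (fun p => hTe.biUnion fun c _ => (𝓕.countable_plaques_meeting p.1.2 c.2 p.2).image _)
    (countable_singleton (c₀, (c₀.1 x).2))
  set L : Set M := {y | ∃ p ∈ W, y ∈ p.1.1.source ∧ (p.1.1 y).2 = p.2} with hL
  have hstep : ∀ y ∈ L, ∀ c ∈ C, y ∈ c.1.source → (c, (c.1 y).2) ∈ W := by
    rintro y ⟨p, hp, hy, hyp⟩ c hc hyc
    exact hsucc p hp (mem_biUnion hc ⟨_, ⟨y, ⟨hy, hyc⟩, hyp, rfl⟩, rfl⟩)
  have hnear : ∀ y ∈ L, ∀ c ∈ C, ∀ z, y ∈ c.1.source → z ∈ c.1.source →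
      (c.1 z).2 = (c.1 y).2 → z ∈ L := fun y hy c hc z hyc hzc h =>
    ⟨_, hstep y hy c hc hyc, hzc, h⟩
  -- Charts outside `C` also define leaves. A plaque of such a chart `d` is connected, and
  -- membership in `L` is locally constant along it because near each point a chart of `C` takes
  -- over.
  have hplaque : ∀ y z, 𝓕.SamePlaque y z → (y ∈ L ↔ z ∈ L) := by
    rintro y z ⟨d, hd, hy, hz, hyz⟩
    obtain ⟨A, T', -, hA, -, hdt⟩ := 𝓕.target_eq d hd
    have hmem : ∀ α ∈ A, (α, (d y).2) ∈ d.target := fun α hα => by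
      have := d.map_source hy
      rw [hdt] at this ⊢
      exact ⟨hα, this.2⟩
    have hyA : (d y).1 ∈ A := by
      have := d.map_source hy
      rw [hdt] at this
      exact this.1
    have hzA : (d z).1 ∈ A := by
      have := d.map_source hz
      rw [hdt] at this
      exact this.1
    have key := hA.induction₂ (fun α β => d.symm (α, (d y).2) ∈ L ↔ d.symm (β, (d y).2) ∈ L)
      (fun α hα => by
        set u := d.symm (α, (d y).2) with hu
        have hud : u ∈ d.source := d.map_target (hmem α hα)
        obtain ⟨c, hcT, huc⟩ := hcover u
        have hc : c ∈ C := mem_insert_of_mem _ hcT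
        have hcont₀ : ContinuousAt (fun β => d.symm (β, (d y).2)) α :=
          (d.continuousAt_symm (hmem α hα)).comp
            (f := fun β => (β, (d y).2)) (Continuous.prodMk_left _).continuousAt
        have hcont : Filter.Tendsto (fun β => d.symm (β, (d y).2)) (𝓝[A] α) (𝓝 u) :=
          hcont₀.mono_left nhdsWithin_le_nhds
        filter_upwards [hcont (𝓕.coherent d hd c.1 c.2 u ⟨hud, huc⟩),
          hcont (c.1.open_source.mem_nhds huc), self_mem_nhdsWithin] with β h1 h2 hβ
        have h3 : (d (d.symm (β, (d y).2))).2 = (d u).2 := by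
          rw [d.right_inv (hmem β hβ), hu, d.right_inv (hmem α hα)]
        have h4 := h1 h3
        exact ⟨fun h => hnear u h c hc _ huc h2 h4, fun h => hnear _ h c hc _ h2 huc h4.symm⟩)
      (fun _ _ _ _ _ _ h h' => h.trans h') (fun _ _ _ _ h => h.symm) hyA hzA
    have hy' : d.symm ((d y).1, (d y).2) = y := d.left_inv hy
    have hz' : d.symm ((d z).1, (d y).2) = z := by rw [hyz]; exact d.left_inv hz
    rwa [hy', hz'] at key
  have hleaf : ∀ y z, 𝓕.SameLeaf y z → (y ∈ L ↔ z ∈ L) := fun y z h => by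
    induction h with
    | rel y z h => exact hplaque y z h
    | refl => exact Iff.rfl
    | symm _ _ _ ih => exact ih.symm
    | trans _ _ _ _ _ ih ih' => exact ih.trans ih'
  have hxL : x ∈ L := ⟨_, hxW rfl, hx, rfl⟩
  refine (hW.preimage (Prod.mk_right_injective (⟨e, he⟩ : 𝓕.atlas))).mono ?_
  rintro _ ⟨y, ⟨hy, hye⟩, rfl⟩
  exact hstep y ((hleaf x y hy).1 hxL) _ (mem_insert _ _) hye

/-- A connected piece of a leaf inside a foliated chart lies in one plaque. -/
theorem constant_plaque_of_isPreconnected [SecondCountableTopology M]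
    {e : OpenPartialHomeomorph M (EuclideanHalfSpace 1 × EuclideanHalfSpace k)}
    (he : e ∈ 𝓕.atlas) {x : M} {X : Type*} [TopologicalSpace X] {s : Set X}
    (hs : IsPreconnected s) {f : X → M} (hf : ContinuousOn f s)
    (hmem : ∀ a ∈ s, f a ∈ 𝓕.leaf x ∩ e.source) {a b : X} (ha : a ∈ s) (hb : b ∈ s) :
    (e (f a)).2 = (e (f b)).2 := by
  -- A countable subset of Euclidean space is totally disconnected, so a connected set of plaque
  -- labels is a single point.
  have hcount := ((𝓕.countable_plaques_of_leaf he x).image Subtype.val).isTotallyDisconnected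
  have hcont : ContinuousOn (fun a => (e (f a)).2.1) s :=
    (continuous_subtype_val.comp continuous_snd).comp_continuousOn
      (e.continuousOn.comp hf fun a ha => (hmem a ha).2)
  refine Subtype.ext (hcount _ ?_ (hs.image _ hcont) (mem_image_of_mem _ ha)
    (mem_image_of_mem _ hb))
  rintro _ ⟨a, ha, rfl⟩
  exact ⟨_, ⟨f a, hmem a ha, rfl⟩, rfl⟩

end LineFoliation

/-! ### Moving points along a circle leaf -/

section LeafPush

open unitInterval

/-- The image of a continuous injective function on a closed interval contains a neighborhood of
the value at the midpoint. -/
theorem exists_Icc_subset_image {α : ℝ → ℝ} {a ρ : ℝ} (hρ : 0 < ρ)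
    (hc : ContinuousOn α (Icc (a - ρ) (a + ρ))) (hi : InjOn α (Icc (a - ρ) (a + ρ))) :
    ∃ y ∈ Icc (a - ρ) (a + ρ), ∃ z ∈ Icc (a - ρ) (a + ρ), α y < α a ∧ α a < α z ∧
      Icc (α y) (α z) ⊆ α '' Icc (a - ρ) (a + ρ) := by
  have hle : a - ρ ≤ a + ρ := by linarith
  have hl : a - ρ ∈ Icc (a - ρ) (a + ρ) := left_mem_Icc.2 hle
  have hr : a + ρ ∈ Icc (a - ρ) (a + ρ) := right_mem_Icc.2 hle
  have hm : a ∈ Icc (a - ρ) (a + ρ) := ⟨by linarith, by linarith⟩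
  rcases hc.strictMonoOn_of_injOn_Icc' hle hi with h | h
  · exact ⟨_, hl, _, hr, h hl hm (by linarith), h hm hr (by linarith),
      intermediate_value_Icc hle hc⟩
  · exact ⟨_, hr, _, hl, h hm hr (by linarith), h hl hm (by linarith),
      intermediate_value_Icc' hle hc⟩

/-- A path in the image of a continuous injective function on a compact set lifts. -/
theorem exists_lift_of_injOn {s : Set ℝ} (hs : IsCompact s) {α : ℝ → ℝ} (hc : ContinuousOn α s)
    (hi : InjOn α s) (p : C(I, ℝ)) (hp : ∀ t, p t ∈ α '' s) :
    ∃ θ : C(I, ℝ), ∀ t, θ t ∈ s ∧ α (θ t) = p t := by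
  have : CompactSpace s := isCompact_iff_compactSpace.1 hs
  have hemb : IsEmbedding (s.domRestrict α) :=
    (hc.domRestrict.isClosedEmbedding (injOn_iff_injective.1 hi)).isEmbedding
  have hp' : ∀ t, p t ∈ range (s.domRestrict α) := fun t => by
    rw [range_domRestrict]
    exact hp t
  refine ⟨⟨fun t => (hemb.toHomeomorph.symm ⟨p t, hp' t⟩ : s), ?_⟩, fun t => ⟨?_, ?_⟩⟩
  · exact continuous_subtype_val.comp
      (hemb.toHomeomorph.symm.continuous.comp (p.continuous.subtype_mk _))
  · exact Subtype.coe_prop _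
  · exact congrArg Subtype.val (hemb.toHomeomorph.apply_symm_apply ⟨p t, hp' t⟩)

variable {r : ℕ∞} {k : ℕ} [NeZero k] {M : Type*} [TopologicalSpace M] [T2Space M]
  [SecondCountableTopology M] [ChartedSpace (EuclideanHalfSpace (k + 1)) M]
  (𝓕 : LineFoliation r k M)

/-- The points of a circle leaf can be moved a little along the leaf, by leaf-preserving isotopies
that are the identity on a closed set disjoint from the leaf. -/
theorem eventually_exists_leaf_push {j : Circle → M} (hj : IsEmbedding j) {x : M}
    (hjx : ∀ z, j z ∈ 𝓕.leaf x) {C : Set M} (hC : IsClosed C) (hjC : ∀ z, j z ∉ C) (a : ℝ) :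
    ∀ᶠ b in 𝓝 a, ∃ F ∈ isotopyGroup (𝓡∂ (k + 1)) r 𝓕.leafDiff, (∀ t, ∀ y ∈ C, F t y = y) ∧
      circleDisplacement j (Circle.exp a) F = b - a := by
  obtain ⟨e, he, hpe⟩ := 𝓕.cover (j (Circle.exp a))
  set f : ℝ → M := fun y => j (Circle.exp y) with hf
  have hfc : Continuous f := hj.continuous.comp Circle.exp.continuous
  -- With `ρ ≤ 1` the interval has length at most `2 < 2π`, so `Circle.exp` is injective on it.
  obtain ⟨ρ, hρ, hρ1, hJe⟩ : ∃ ρ > 0, ρ ≤ 1 ∧ ∀ y ∈ Icc (a - ρ) (a + ρ), f y ∈ e.source := by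
    obtain ⟨ρ, hρ, hb⟩ := Metric.nhds_basis_closedBall.mem_iff.1
      ((e.open_source.preimage hfc).mem_nhds hpe)
    refine ⟨min ρ 1, lt_min hρ one_pos, min_le_right _ _, fun y hy => hb ?_⟩
    rw [← Real.closedBall_eq_Icc] at hy
    exact Metric.closedBall_subset_closedBall (min_le_left _ _) hy
  set S := Icc (a - ρ) (a + ρ) with hS
  have haS : a ∈ S := ⟨by linarith, by linarith⟩
  have hplaque : ∀ y ∈ S, (e (f y)).2 = (e (f a)).2 := fun y hy =>
    𝓕.constant_plaque_of_isPreconnected he isPreconnected_Icc hfc.continuousOn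
      (fun b hb => ⟨hjx _, hJe b hb⟩) hy haS
  set α : ℝ → ℝ := fun y => (e (f y)).1.1 0 with hα
  have hαc : ContinuousOn α S :=
    (continuous_coord.comp continuous_fst).comp_continuousOn
      (e.continuousOn.comp hfc.continuousOn hJe)
  have hef : ∀ y ∈ S, e (f y) = (halfLine (α y), (e (f a)).2) := fun y hy =>
    Prod.ext (halfLine_self _).symm (hplaque y hy)
  have hαi : InjOn α S := fun y hy y' hy' h => by
    have h1 : f y = f y' := e.injOn (hJe y hy) (hJe y' hy') (by rw [hef y hy, hef y' hy', h])
    obtain ⟨m, hm⟩ := Circle.exp_eq_exp.1 (hj.injective h1)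
    have hpi := Real.pi_gt_three
    have hm1 : |(m : ℝ)| < 1 := by
      have h2 : |(m : ℝ) * (2 * Real.pi)| ≤ 2 := by
        rw [show (m : ℝ) * (2 * Real.pi) = y - y' by linarith, abs_le]
        constructor <;> linarith [hy.1, hy.2, hy'.1, hy'.2]
      rw [abs_mul, abs_of_pos Real.two_pi_pos] at h2
      nlinarith [abs_nonneg (m : ℝ)]
    have hm0 : m = 0 := by
      rw [← Int.abs_lt_one_iff]
      exact_mod_cast hm1
    rw [hm, hm0]
    simp
  obtain ⟨y₁, hy₁, y₂, hy₂, hlt₁, hlt₂, himg⟩ := exists_Icc_subset_image hρ hαc hαi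
  -- The leaf continues on both sides of `f a` in the plaque, so `f a` is not at the end of the half
  -- line.
  have hpos : 0 < (e (f a)).1.1 0 := lt_of_le_of_lt (e (f y₁)).1.2 hlt₁
  have hW : e.target ∩ e.symm ⁻¹' Cᶜ ∈ 𝓝 (e (f a)) := by
    refine Filter.inter_mem (e.open_target.mem_nhds (e.map_source hpe))
      ((e.continuousAt_symm (e.map_source hpe)).preimage_mem_nhds (hC.isOpen_compl.mem_nhds ?_))
    rw [e.left_inv hpe]
    exact hjC _
  -- This `ε` confines the moving point to the arc `f '' S`, so its path lifts to an angle `θ` with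
  -- values in `S`.
  obtain ⟨η, hη, K, hKW, hK, hpush⟩ := exists_product_push r hW hpos
    (ε := min (α a - α y₁) (α y₂ - α a)) (lt_min (by linarith) (by linarith))
  have hSn : S ∈ 𝓝 a := Icc_mem_nhds (by linarith) (by linarith)
  filter_upwards [hSn, (hαc.continuousAt hSn).eventually (Metric.ball_mem_nhds _ hη)] with b hb hbη
  obtain ⟨Φ, p, hΦ, hΦ0, hΦK, hΦ2, hΦp, hp0, hp1, hpε⟩ := hpush (α b) (by
    rwa [← Real.dist_eq])
  have hKe : K ⊆ e.target := fun y hy => (hKW hy).1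
  obtain ⟨F, hF, hF0, hFe, hFK⟩ := exists_isotopy_of_chart (𝓕.contMDiffOn e he)
    (𝓕.contMDiffOn_symm e he) hK hKe hΦ hΦK hΦ0
  obtain ⟨θ, hθ⟩ := exists_lift_of_injOn isCompact_Icc hαc hαi p fun t => himg (by
    have h1 := lt_min_iff.1 (hpε t)
    have h2 := abs_lt.1 h1.1
    have h3 := abs_lt.1 h1.2
    constructor <;> linarith [h2.1, h3.2])
  have hθ0 : θ 0 = a := hαi (hθ 0).1 haS ((hθ 0).2.trans hp0)
  have hθ1 : θ 1 = b := hαi (hθ 1).1 hb ((hθ 1).2.trans hp1)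
  refine ⟨F, ⟨hF, fun t => ⟨hF.mem_diffGroup t, fun y => ?_⟩, hF0⟩, fun t y hy => ?_, ?_⟩
  · by_cases hy : y ∈ e.source
    · have hmem := mapsTo_of_perm_eq_self hKe (hΦK t) (e.map_source hy)
      refine Relation.EqvGen.rel _ _ ⟨e, he, hy, ?_, ?_⟩
      · rw [hFe t y hy]
        exact e.map_target hmem
      · rw [hFe t y hy, e.right_inv hmem, hΦ2]
    · rw [hFK t y]
      · exact Relation.EqvGen.refl y
      · rintro ⟨q, hq, rfl⟩
        exact hy (e.map_target (hKe hq))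
  · refine hFK t y ?_
    rintro ⟨q, hq, rfl⟩
    exact (hKW hq).2 hy
  · rw [circleDisplacement_eq hj θ.continuous fun t => ?_, hθ0, hθ1]
    change F t (f a) = f (θ t)
    rw [hFe t _ hpe, hΦp, ← (hθ t).2, ← hef _ (hθ t).1, e.left_inv (hJe _ (hθ t).1)]

theorem trace_one_eq {E : Type*} [NormedAddCommGroup E] [NormedSpace ℝ E] {H : Type*}
    [TopologicalSpace H] {M : Type*} [TopologicalSpace M] [ChartedSpace H M]
    {J : ModelWithCorners ℝ E H} {r : ℕ∞} {G : Subgroup (Equiv.Perm M)} {j : Circle → M}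
    (hj : IsEmbedding j) (hG : ∀ f ∈ G, ∀ z, f (j z) ∈ range j) {F : I → Equiv.Perm M}
    (hF : F ∈ isotopyGroup J r G) (a : ℝ) :
    trace j F (Circle.exp a) 1 =
      Circle.exp (a + circleDisplacement j (Circle.exp a) F) := by
  obtain ⟨θ, hθ0, hθ⟩ := exists_angle_lift (γ := trace j F (Circle.exp a))
    ((continuous_trace hj hG hF).comp (Continuous.prodMk_right _)) (trace_zero hj hF _).symm
  rw [circleDisplacement, displacement_eq θ.continuous hθ, hθ0, add_sub_cancel, hθ]

theorem circleDisplacement_of_fixed {M : Type*} [TopologicalSpace M] {j : Circle → M}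
    (hj : IsEmbedding j) {F : I → Equiv.Perm M} (h : ∀ t z, F t (j z) = j z) (z : Circle) :
    circleDisplacement j z F = 0 := by
  obtain ⟨x, rfl⟩ := Circle.exp_surjective z
  rw [circleDisplacement_eq (θ := fun _ => x) hj continuous_const fun t => h t _, sub_self]

/-- Every displacement along a circle leaf is realized by a leaf-preserving isotopy that is the
identity on a given closed set disjoint from the leaf. -/
theorem exists_leaf_isotopy_displacement {j : Circle → M} (hj : IsEmbedding j) {x : M}
    (hjx : range j = 𝓕.leaf x) {C : Set M} (hC : IsClosed C) (hjC : ∀ z, j z ∉ C) (z : Circle)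
    (s : ℝ) :
    ∃ F ∈ isotopyGroup (𝓡∂ (k + 1)) r 𝓕.leafDiff, (∀ t, ∀ y ∈ C, F t y = y) ∧
      circleDisplacement j z F = s := by
  have hmem : ∀ z, j z ∈ 𝓕.leaf x := fun z => hjx ▸ mem_range_self z
  have hG : ∀ f ∈ 𝓕.leafDiff, ∀ z, f (j z) ∈ range j := fun f hf z => by
    rw [hjx]
    exact Relation.EqvGen.trans _ _ _ (hmem z) (hf.2 _)
  obtain ⟨a, rfl⟩ := Circle.exp_surjective z
  -- That `b` can be reached from `a` is a symmetric and transitive relation that holds locally,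
  -- hence everywhere on the connected line. Working with angles in `ℝ` rather than points of the
  -- circle keeps count of full turns.
  have key := isPreconnected_univ.induction₂ (fun a b : ℝ =>
      ∃ F ∈ isotopyGroup (𝓡∂ (k + 1)) r 𝓕.leafDiff, (∀ t, ∀ y ∈ C, F t y = y) ∧
        circleDisplacement j (Circle.exp a) F = b - a)
    (fun a _ => (eventually_exists_leaf_push 𝓕 hj hmem hC hjC a).filter_mono nhdsWithin_le_nhds)
    ?_ ?_ (mem_univ a) (mem_univ (a + s))
  · simpa using key
  · rintro a b c - - - ⟨F, hF, hFC, hFd⟩ ⟨F', hF', hFC', hFd'⟩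
    refine ⟨F' * F, mul_mem hF' hF, fun t y hy => ?_, ?_⟩
    · rw [Pi.mul_apply, Equiv.Perm.mul_apply, hFC t y hy, hFC' t y hy]
    · rw [circleDisplacement_mul hj hG hF' hF, trace_one_eq hj hG hF, hFd, add_sub_cancel, hFd']
      ring
  · rintro a b - - ⟨F, hF, hFC, hFd⟩
    refine ⟨F⁻¹, inv_mem hF, fun t y hy => ?_, ?_⟩
    · rw [Pi.inv_apply, Equiv.Perm.inv_eq_iff_eq, hFC t y hy]
    · have h := circleDisplacement_mul hj hG (inv_mem hF) hF (Circle.exp a)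
      rw [inv_mul_cancel, circleDisplacement_of_fixed hj (fun _ _ => rfl), trace_one_eq hj hG hF,
        hFd, add_sub_cancel] at h
      linarith

end LeafPush

/-! ### Parallel circle leaves -/

section Parallel

open unitInterval

/-- If two maps of the square agree on three sides, then their restrictions to the fourth side are
homotopic paths. -/
theorem homotopic_of_eq_on_three_sides {X : Type*} [TopologicalSpace X] (Q Q' : C(I × I, X))
    (h0 : ∀ s, Q (s, 0) = Q' (s, 0)) (h1 : ∀ s, Q (s, 1) = Q' (s, 1))
    (hr : ∀ t, Q (1, t) = Q' (1, t)) {x : X} {γ γ' : Path x x} (hγ : ∀ t, γ t = Q (0, t))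
    (hγ' : ∀ t, γ' t = Q' (0, t)) : γ.Homotopic γ' := by
  have : ContractibleSpace I := Convex.contractibleSpace (convex_Icc 0 1) ⟨0, by simp⟩
  let A : Path ((0, 0) : I × I) (1, 0) := ⟨⟨fun s => (s, 0), by fun_prop⟩, rfl, rfl⟩
  let B : Path ((1, 0) : I × I) (1, 1) := ⟨⟨fun t => (1, t), by fun_prop⟩, rfl, rfl⟩
  let D : Path ((0, 1) : I × I) (1, 1) := ⟨⟨fun s => (s, 1), by fun_prop⟩, rfl, rfl⟩
  let L : Path ((0, 0) : I × I) (0, 1) := ⟨⟨fun t => (0, t), by fun_prop⟩, rfl, rfl⟩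
  let P := (A.trans B).trans D.symm
  have hP : ∀ t, Q (P t) = Q' (P t) := fun t => by
    have hmem : P t ∈ range P := mem_range_self t
    rw [Path.trans_range, Path.trans_range, Path.symm_range] at hmem
    rcases hmem with (⟨s, hs⟩ | ⟨s, hs⟩) | ⟨s, hs⟩ <;> rw [← hs]
    exacts [h0 s, hr s, h1 s]
  have hLP : L.Homotopic P := SimplyConnectedSpace.paths_homotopic L P
  have hx0 : x = Q (0, 0) := by rw [← hγ, γ.source]
  have hx1 : x = Q (0, 1) := by rw [← hγ, γ.target]
  have hx0' : x = Q' (0, 0) := by rw [← hγ', γ'.source]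
  have hx1' : x = Q' (0, 1) := by rw [← hγ', γ'.target]
  -- `L` is the fourth side and `P` runs along the other three. They are homotopic in the square,
  -- and `Q` and `Q'` agree on `P`.
  have e1 := (Path.Homotopic.map hLP Q).pathCast hx0 hx1
  have e2 := (Path.Homotopic.map hLP Q').pathCast hx0' hx1'
  have hγL : (L.map Q.continuous).cast hx0 hx1 = γ := by
    ext t
    exact (hγ t).symm
  have hγL' : (L.map Q'.continuous).cast hx0' hx1' = γ' := by
    ext t
    exact (hγ' t).symm
  have hPP : (P.map Q.continuous).cast hx0 hx1 = (P.map Q'.continuous).cast hx0' hx1' := by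
    ext t
    exact hP t
  rw [hγL, hPP] at e1
  rw [hγL'] at e2
  exact e1.trans e2.symm

theorem homotopic_of_map_inclusion {M : Type*} [TopologicalSpace M] {S N : Set M} {hSN : S ⊆ N}
    {p : S} (hinj : InclusionPi1Injective hSN p) {γ γ' : Path p p}
    (h : (γ.map (continuous_inclusion hSN)).Homotopic (γ'.map (continuous_inclusion hSN))) :
    γ.Homotopic γ' := by
  have key : FundamentalGroup.map (⟨Set.inclusion hSN, continuous_inclusion hSN⟩ : C(S, N)) p
      (Path.Homotopic.Quotient.mk γ) =
    FundamentalGroup.map (⟨Set.inclusion hSN, continuous_inclusion hSN⟩ : C(S, N)) p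
      (Path.Homotopic.Quotient.mk γ') := Quotient.sound h
  exact Path.Homotopic.Quotient.exact (hinj key)

/-- The two boundary circles of the annulus have the same displacement under an isotopy that
returns to the identity. -/
theorem circleDisplacement_eq_of_parallel {V : Type*} [NormedAddCommGroup V] [NormedSpace ℝ V]
    {H : Type*} [TopologicalSpace H] {M : Type*} [TopologicalSpace M] [ChartedSpace H M]
    {J : ModelWithCorners ℝ V H} {r : ℕ∞} {h : Circle × I → M} (hh : IsEmbedding h)
    {G : Subgroup (Equiv.Perm M)} (hG₀ : ∀ f ∈ G, ∀ z, f (h (z, 0)) ∈ range fun z => h (z, 0))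
    (hG₁ : ∀ f ∈ G, ∀ z, f (h (z, 1)) ∈ range fun z => h (z, 1)) {N : Set M}
    (hN : ∀ f ∈ G, ∀ x ∈ N, f x ∈ N) (hhN : range h ⊆ N) {S : Set M}
    (hS : S = range fun z => h (z, 0)) (hSN : S ⊆ N) {z₀ : Circle} {p : S}
    (hp : h (z₀, 0) = p) (hinj : InclusionPi1Injective hSN p)
    {F : I → Equiv.Perm M} (hF : F ∈ isotopyGroup J r G) (hF1 : F 1 = 1) :
    circleDisplacement (fun z => h (z, 0)) z₀ F = circleDisplacement (fun z => h (z, 1)) z₀ F := by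
  have hj : ∀ s : I, IsEmbedding (fun z => h (z, s)) := fun s =>
    hh.comp (isEmbedding_prodMkLeft s)
  set c₀ := trace (fun z => h (z, 0)) F z₀ with hc₀
  set c₁ := trace (fun z => h (z, 1)) F z₀ with hc₁
  have hcont₀ : Continuous c₀ :=
    (continuous_trace (hj 0) hG₀ hF).comp (Continuous.prodMk_right z₀)
  have hcont₁ : Continuous c₁ :=
    (continuous_trace (hj 1) hG₁ hF).comp (Continuous.prodMk_right z₀)
  have h₀ : ∀ t, h (c₀ t, 0) = F t (h (z₀, 0)) := map_trace hG₀ hF z₀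
  have h₁ : ∀ t, h (c₁ t, 1) = F t (h (z₀, 1)) := map_trace hG₁ hF z₀
  have hc₀0 : c₀ 0 = z₀ := trace_zero (hj 0) hF z₀
  have hc₁0 : c₁ 0 = z₀ := trace_zero (hj 1) hF z₀
  have hc₀1 : c₀ 1 = z₀ := trace_eq (hj 0) (by rw [hF1]; rfl)
  have hc₁1 : c₁ 1 = z₀ := trace_eq (hj 1) (by rw [hF1]; rfl)
  have hmem : ∀ z, h (z, 0) ∈ S := fun z => hS ▸ mem_range_self z
  let ι : C(Circle, S) := ⟨fun z => ⟨h (z, 0), hmem z⟩, (hj 0).continuous.subtype_mk _⟩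
  have hι : ι z₀ = p := Subtype.ext hp
  let γ₀ : Path p p := ⟨⟨fun t => ι (c₀ t), by fun_prop⟩, by simp [hc₀0, hι], by simp [hc₀1, hι]⟩
  let γ₁ : Path p p := ⟨⟨fun t => ι (c₁ t), by fun_prop⟩, by simp [hc₁0, hι], by simp [hc₁1, hι]⟩
  have hhomot : γ₀.Homotopic γ₁ := by
    refine homotopic_of_map_inclusion hinj ?_
    -- `Q` moves the arc `h (z₀, ·)` by the isotopy and `Q'` carries the trace `c₁` across the
    -- annulus. They agree at `s = 1` and at `t = 0, 1`; on the side `s = 0` they give `γ₀` and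
    -- `γ₁`.
    let Q : C(I × I, N) := ⟨fun q => ⟨F q.2 (h (z₀, q.1)), hN _ (hF.2.1 _) _ (hhN ⟨_, rfl⟩)⟩,
      (hF.1.1.continuous.comp ((hh.continuous.comp (by fun_prop :
        Continuous fun q : I × I => (z₀, q.1))).prodMk continuous_snd)).subtype_mk _⟩
    let Q' : C(I × I, N) := ⟨fun q => ⟨h (c₁ q.2, q.1), hhN ⟨_, rfl⟩⟩,
      (hh.continuous.comp (by fun_prop :
        Continuous fun q : I × I => (c₁ q.2, q.1))).subtype_mk _⟩
    refine homotopic_of_eq_on_three_sides Q Q' (fun s => ?_) (fun s => ?_) (fun t => ?_)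
      (fun t => ?_) fun t => ?_
    · refine Subtype.ext ?_
      change F 0 (h (z₀, s)) = h (c₁ 0, s)
      rw [hc₁0, hF.2.2]
      rfl
    · refine Subtype.ext ?_
      change F 1 (h (z₀, s)) = h (c₁ 1, s)
      rw [hc₁1, hF1]
      rfl
    · exact Subtype.ext (h₁ t).symm
    · exact Subtype.ext (h₀ t)
    · rfl
  obtain ⟨K⟩ := hhomot
  have hSr : ∀ q : S, (q : M) ∈ range fun z => h (z, 0) := fun q => hS ▸ q.2
  let ψ : C(S, Circle) := ⟨fun q => (hj 0).toHomeomorph.symm ⟨q, hSr q⟩,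
    (hj 0).toHomeomorph.symm.continuous.comp (continuous_subtype_val.subtype_mk _)⟩
  have hψ : ∀ z, ψ (ι z) = z := fun z => (hj 0).toHomeomorph.symm_apply_apply z
  have key := displacement_eq_of_homotopy_loops (H := fun s t => ψ (K (s, t)))
    (by simpa [Function.uncurry_def] using (by fun_prop : Continuous fun q => ψ (K q)))
    (fun s => by simp)
  have e0 : (fun t => ψ (K (0, t))) = c₀ := by
    ext1 t
    rw [K.apply_zero]
    exact hψ (c₀ t)
  have e1 : (fun t => ψ (K (1, t))) = c₁ := by
    ext1 t
    rw [K.apply_one]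
    exact hψ (c₁ t)
  change displacement c₀ = displacement c₁
  rwa [e0, e1] at key

variable {r : ℕ∞} {k : ℕ} [NeZero k] {M : Type*} [TopologicalSpace M]
  [ChartedSpace (EuclideanHalfSpace (k + 1)) M] (𝓕 : LineFoliation r k M)

/-- Leaf-preserving maps preserve the saturated set `N`, so the annulus argument takes place inside
`N`. As `S₂` is closed and disjoint from `S₁`, pushes along `S₁` can be chosen to fix it. -/
theorem admitsSurjectiveQuasimorphism_leafDiff₀ [T2Space M] [SecondCountableTopology M]
    {S₁ S₂ E N : Set M} (hS₁ : 𝓕.IsCircleLeaf S₁) (hS₂ : 𝓕.IsCircleLeaf S₂)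
    (hpar : AreParallel S₁ S₂ E) (hN : 𝓕.IsSaturated N) (hEN : E ⊆ N) (hSN : S₁ ⊆ N) (p : S₁)
    (hinj : InclusionPi1Injective hSN p) :
    AdmitsSurjectiveQuasimorphism 𝓕.leafDiff₀ := by
  obtain ⟨h, hh, rfl, h0, h1⟩ := hpar
  obtain ⟨⟨x₁, hx₁⟩, -⟩ := hS₁
  obtain ⟨⟨x₂, hx₂⟩, -⟩ := hS₂
  have hj : ∀ s : I, IsEmbedding (fun z => h (z, s)) := fun s =>
    hh.comp (isEmbedding_prodMkLeft s)
  have hr₁ : range (fun z => h (z, 0)) = S₁ := by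
    rw [← h0]
    ext y
    simp
  have hr₂ : range (fun z => h (z, 1)) = S₂ := by
    rw [← h1]
    ext y
    simp
  have hG : ∀ (s : I) (x : M), range (fun z => h (z, s)) = 𝓕.leaf x → ∀ f ∈ 𝓕.leafDiff, ∀ z,
      f (h (z, s)) ∈ range fun z => h (z, s) := fun s x hx f hf z => by
    have hz : h (z, s) ∈ 𝓕.leaf x := hx ▸ mem_range_self z
    rw [hx]
    exact Relation.EqvGen.trans _ _ _ hz (hf.2 _)
  have hG₁ := hG 0 x₁ (hr₁.trans hx₁)
  have hG₂ := hG 1 x₂ (hr₂.trans hx₂)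
  obtain ⟨z₀, hz₀⟩ : (p : M) ∈ range fun z => h (z, 0) := hr₁ ▸ p.2
  have hC : IsClosed S₂ := by
    rw [← hr₂]
    exact (isCompact_range (hj 1).continuous).isClosed
  have hdisj : ∀ z, h (z, 0) ∉ S₂ := fun z hz => by
    rw [← hr₂] at hz
    obtain ⟨w, hw⟩ := hz
    exact one_ne_zero (congrArg Prod.snd (hh.injective hw))
  refine admitsSurjectiveQuasimorphism_of_displacement (z₁ := z₀) (z₂ := z₀) (hj 0) (hj 1) hG₁ hG₂
    (fun F hF hF1 => circleDisplacement_eq_of_parallel hh hG₁ hG₂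
      (fun f hf x hx => hN x hx (hf.2 x)) hEN hr₁.symm hSN hz₀ hinj hF hF1) fun s => ?_
  obtain ⟨F, hF, hFC, hFd⟩ :=
    exists_leaf_isotopy_displacement 𝓕 (hj 0) (hr₁.trans hx₁) hC hdisj z₀ s
  refine ⟨F, hF, ?_⟩
  rw [hFd, circleDisplacement_of_fixed (hj 1) (fun t z => hFC t _ (hr₂ ▸ mem_range_self z)),
    sub_zero]

/-- A boundary circle of an annulus is a retract of the annulus. -/
theorem AreParallel.inclusionPi1Injective {M : Type*} [TopologicalSpace M] {S₁ S₂ E : Set M}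
    (hpar : AreParallel S₁ S₂ E) :
    ∃ hSE : S₁ ⊆ E, ∀ p : S₁, InclusionPi1Injective hSE p := by
  obtain ⟨h, hh, rfl, rfl, -⟩ := hpar
  refine ⟨image_subset_range _ _, fun p => ?_⟩
  have hmem : ∀ z, h (z, 0) ∈ h '' (univ ×ˢ {0}) := fun z => ⟨(z, 0), by simp, rfl⟩
  -- The retraction slides every point of the annulus to height `0`.
  let ρ : C(range h, h '' (univ ×ˢ {0})) := ⟨fun y => ⟨h ((hh.toHomeomorph.symm y).1, 0), hmem _⟩,
    (hh.continuous.comp ((continuous_fst.comp hh.toHomeomorph.symm.continuous).prodMk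
      continuous_const)).subtype_mk _⟩
  have hρ : ∀ q : h '' (univ ×ˢ {0}), ρ (Set.inclusion (image_subset_range _ _) q) = q := by
    rintro ⟨_, ⟨z, s⟩, hs, rfl⟩
    obtain rfl : s = 0 := by simpa using hs
    apply Subtype.ext
    change h ((hh.toHomeomorph.symm (hh.toHomeomorph (z, 0))).1, 0) = h (z, 0)
    rw [Homeomorph.symm_apply_apply]
  have e : ∀ c : Path p p, ((c.map (continuous_inclusion (image_subset_range h _))).map
      ρ.continuous).cast (hρ p).symm (hρ p).symm = c := fun c => by
    ext t
    exact congrArg Subtype.val (hρ (c t))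
  have key : ∀ a b : Path p p, (a.map (continuous_inclusion (image_subset_range h _))).Homotopic
      (b.map (continuous_inclusion (image_subset_range h _))) → a.Homotopic b := fun a b hab => by
    have h2 := (hab.map ρ).pathCast (hρ p).symm (hρ p).symm
    rwa [e, e] at h2
  rintro ⟨a⟩ ⟨b⟩ hab
  exact Quotient.sound (key a b (Path.Homotopic.Quotient.exact hab))

end Parallel

end CircleFoliation

end

theorem mainTheorem8 (r : ℕ∞) (k : ℕ) [NeZero k] :
    -- circle bundles
    (∀ (B : Type*) [TopologicalSpace B] [T2Space B] [SecondCountableTopology B] [Nonempty B]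
      [ChartedSpace (EuclideanHalfSpace k) B] [IsManifold (𝓡∂ k) r B]
      (M : Type*) [TopologicalSpace M] [T2Space M] [SecondCountableTopology M]
      [ChartedSpace (EuclideanHalfSpace (k + 1)) M] [IsManifold (𝓡∂ (k + 1)) r M]
      (Γ : Subgroup (Equiv.Perm Circle)) (π : M → B)
      (ξ : CircleFoliation.CircleBundle (𝓡∂ k) (𝓡∂ (k + 1)) r Γ π),
      CircleFoliation.rotationGroup ≤ Γ → Γ ≤ CircleFoliation.diffGroup (𝓡 1) r Circle →
      CircleFoliation.AdmitsSurjectiveQuasimorphism ξ.bundleDiff₀) ∧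
    -- foliations with two parallel circle leaves
    (∀ (M : Type*) [TopologicalSpace M] [T2Space M] [SecondCountableTopology M]
      [ChartedSpace (EuclideanHalfSpace (k + 1)) M] [IsManifold (𝓡∂ (k + 1)) r M]
      (𝓕 : CircleFoliation.LineFoliation r k M) (S₁ S₂ E : Set M),
      𝓕.IsCircleLeaf S₁ → 𝓕.IsCircleLeaf S₂ →
      S₁ ⊆ (𝓡∂ (k + 1)).interior M → S₂ ⊆ (𝓡∂ (k + 1)).interior M →
      CircleFoliation.AreParallel S₁ S₂ E →
      (∀ (N : Set M), 𝓕.IsSaturated N → E ⊆ N →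
        ∀ (hS₁N : S₁ ⊆ N) (p : S₁), CircleFoliation.InclusionPi1Injective hS₁N p →
        CircleFoliation.AdmitsSurjectiveQuasimorphism 𝓕.leafDiff₀) ∧
      -- if the annulus itself is saturated, one may take `N = E`
      (𝓕.IsSaturated E →
        (∃ hS₁E : S₁ ⊆ E, ∀ p : S₁, CircleFoliation.InclusionPi1Injective hS₁E p) ∧
        CircleFoliation.AdmitsSurjectiveQuasimorphism 𝓕.leafDiff₀)) := by
  refine ⟨?_, ?_⟩
  · intro B _ _ _ _ _ _ M _ _ _ _ _ Γ π ξ hΓ _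
    exact CircleFoliation.admitsSurjectiveQuasimorphism_bundleDiff₀ ξ hΓ (Classical.arbitrary B)
      fun U hU => CircleFoliation.exists_path_ne (k := k) _ hU
  · intro M _ _ _ _ _ 𝓕 S₁ S₂ E hS₁ hS₂ _ _ hpar
    have key : ∀ N : Set M, 𝓕.IsSaturated N → E ⊆ N → ∀ (hS₁N : S₁ ⊆ N) (p : S₁),
        CircleFoliation.InclusionPi1Injective hS₁N p →
        CircleFoliation.AdmitsSurjectiveQuasimorphism 𝓕.leafDiff₀ := fun N hN hEN hSN p hp =>
      CircleFoliation.admitsSurjectiveQuasimorphism_leafDiff₀ 𝓕 hS₁ hS₂ hpar hN hEN hSN p hp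
    refine ⟨key, fun hE => ?_⟩
    obtain ⟨hSE, hinj⟩ := hpar.inclusionPi1Injective
    obtain ⟨⟨x, hx⟩, -⟩ := hS₁
    have hxS : x ∈ S₁ := hx ▸ Relation.EqvGen.refl x
    exact ⟨⟨hSE, hinj⟩, key E hE subset_rfl hSE ⟨x, hxS⟩ (hinj _)⟩
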